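/- Let $\mathsf H$ be a separable real Hilbert space of real-valued measurable functions on $\mathbb R_+=[0,\infty)$, and let $\mathsf C$ be a separable real Hilbert space. Assume that for every $t\ge 0$ the shift $\mathcal S(t)f=f(t+\cdot)$ is a bounded linear operator on $\mathsf H$. Let $U=(U_1,U_2)$ be a bivariate square integrable Lévy process with mean zero on a probability space, let $g_1,g_2\in\mathsf H$ be such that $s\mapsto g_k(s+\cdot)=\mathcal S(s)g_k$ belongs to $L^2(\mathbb R_+;\mathsf H)$ for $k=1,2$ (it is strongly measurable and $|g_k(s+\cdot)|_{\mathsf H}\in L^2(\mathbb R_+)$), and let $h_1,h_2:\mathbb R_+\to\mathsf H$ be deterministic with $h_1(t)-h_2(t)\to h_\infty$ in $\mathsf H$ as $t\to\infty$. For $k=1,2$ and $t\ge 0$ put, almost surely, $$X_k(t)=h_k(t)+\int_0^t \mathcal S(t-s)g_k\,dU_k(s),$$ where the integral is the $L^2(\Omega;\mathsf H)$-limit of the elementary integrals of $\mathsf H$-valued step functions approximating the integrand in $L^2([0,t];\mathsf H)$. Let $X_3$ be any $\mathsf H$-valued process (for instance $X_3(t)=L(t)\mathbf 1$ with a real-valued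 Lévy process $L$, if $\mathsf H$ contains the constant function $\mathbf 1$), and let $\mathcal C_1:\mathsf H\to\mathsf C$ be bounded and linear. The cumulant of a probability distribution is the distinguished logarithm of its characteristic function, that is, the continuous function which vanishes at $0$ and whose exponential is the characteristic function. Let $\psi_U$ be the cumulant of $U(1)$. Then the stochastic integrals and the cumulants of $U(1)$ and of $\mathcal C_1(X_1(t)-X_2(t))$, $t\ge0$, exist; for every $u\in\mathsf C$ the function $s\mapsto\psi_U\big((\mathcal C_1^*u,g_1(s+\cdot))_{\mathsf H},-(\mathcal C_1^*u,g_2(s+\cdot))_{\mathsf H}\big)$ is integrable on $\mathbb R_+$; and, as $t\to\infty$, $\mathcal C_1(X_1(t)-X_2(t))$ converges in distribution (weakly) to a probability distribution on $\mathsf C$ with cumulant $$u\mapsto \lim_{t\to\infty}\log\mathbb E\big[e^{\mathrm i(u,\mathcal C_1(X_1(t)-X_2(t)))_{\mathsf C}}\big]=\mathrm i\,(u,\mathcal C_1h_\infty)_{\mathsf C}+\int_0^\infty\psi_U\big((\mathcal C_1^*u,g_1(s+\cdot))_{\mathsf H},-(\mathcal C_1^*u,g_2(s+\cdot))_{\mathsf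 H}\big)\,ds .$$ Consequently the three-factor model $X=(X_1,X_2,X_3)$ with (log-)forward prices $\mathcal P X=(X_1+X_3,\,X_2+X_3)$ is cointegrated: with $\mathcal C=[\mathcal C_1\ \ {-\mathcal C_1}]$, the process $\mathcal C\mathcal P X(t)$ admits a limiting distribution in $\mathsf C$. -/

import Mathlib

open MeasureTheory ProbabilityTheory Filter Topology
open scoped NNReal ENNReal InnerProductSpace

/-- A Lévy process (in law) with values in a normed space `E`: it starts at zero, has independent
and stationary increments and is stochastically continuous. -/
structure IsLevyProcess {Ω E : Type*} [MeasurableSpace Ω] [NormedAddCommGroup E]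
    [MeasurableSpace E] (P : Measure Ω) (U : ℝ≥0 → Ω → E) : Prop where
  zero : ∀ᵐ ω ∂P, U 0 ω = 0
  indep_increments : HasIndepIncrements U P
  stationary_increments : ∀ s t : ℝ≥0, IdentDistrib (fun ω => U (s + t) ω - U s ω) (U t) P P
  stoch_continuous : ∀ t : ℝ≥0, TendstoInMeasure P U (𝓝 t) (U t)

/-- An `E`-valued step function `∑ i, 1_{(lo i, hi i]} · val i` on the half line, given through a
finite family of intervals. -/
structure StepFunction (E : Type*) where
  n : ℕ
  lo : Fin n → ℝ≥0
  hi : Fin n → ℝ≥0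
  lo_le_hi : ∀ i, lo i ≤ hi i
  val : Fin n → E

/-- The function on the half line given by a step function. -/
noncomputable def StepFunction.eval {E : Type*} [AddCommMonoid E] (φ : StepFunction E) :
    ℝ → E :=
  fun s => ∑ i, (Set.Ioc (φ.lo i : ℝ) (φ.hi i)).indicator (fun _ => φ.val i) s

/-- The elementary stochastic integral `∑ i, (V (hi i) - V (lo i)) • val i` of a step function
with respect to a real-valued process `V`. -/
noncomputable def StepFunction.integral {Ω E : Type*} [AddCommMonoid E] [Module ℝ E]
    (φ : StepFunction E) (V : ℝ≥0 → Ω → ℝ) : Ω → E :=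
  fun ω => ∑ i, (V (φ.hi i) ω - V (φ.lo i) ω) • φ.val i

/-- `Z` is (a version of) the stochastic integral `∫₀ᵗ f(s) dV(s)` of the deterministic
`E`-valued integrand `f ∈ L²([0,t]; E)`: it is the limit in `L²(Ω; E)` of the elementary integrals
of step functions on `[0,t]` that converge to `f` in `L²([0,t]; E)`. -/
def IsStochIntegral {Ω E : Type*} [MeasurableSpace Ω] [NormedAddCommGroup E] [NormedSpace ℝ E]
    (P : Measure Ω) (V : ℝ≥0 → Ω → ℝ) (f : ℝ → E) (t : ℝ≥0) (Z : Ω → E) : Prop :=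
  MemLp f 2 (volume.restrict (Set.Ioc (0 : ℝ) t)) ∧ MemLp Z 2 P ∧
    ∃ φ : ℕ → StepFunction E,
      (∀ m i, (φ m).hi i ≤ t) ∧
      Tendsto (fun m => eLpNorm (fun s => f s - (φ m).eval s) 2 (volume.restrict (Set.Ioc (0 : ℝ) t)))
        atTop (𝓝 0) ∧
      Tendsto (fun m => eLpNorm (fun ω => Z ω - (φ m).integral V ω) 2 P) atTop (𝓝 0)

open Classical in
/-- The stochastic integral `∫₀ᵗ f(s) dV(s)` (and `0` if it does not exist). -/
noncomputable def stochIntegral {Ω E : Type*} [MeasurableSpace Ω] [NormedAddCommGroup E]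
    [NormedSpace ℝ E] (P : Measure Ω) (V : ℝ≥0 → Ω → ℝ) (f : ℝ → E) (t : ℝ≥0) : Ω → E :=
  if hex : ∃ Z, IsStochIntegral P V f t Z then hex.choose else 0

/-- `ψ` is the cumulant of `μ`, that is, the distinguished logarithm of its characteristic
function: the continuous function vanishing at zero whose exponential is the characteristic
function. -/
def IsCumulant {E : Type*} [NormedAddCommGroup E] [InnerProductSpace ℝ E] [MeasurableSpace E]
    (μ : Measure E) (ψ : E → ℂ) : Prop :=
  Continuous ψ ∧ ψ 0 = 0 ∧ ∀ u, Complex.exp (ψ u) = charFun μ u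

open Classical in
/-- The cumulant of `μ` (and `0` if the distinguished logarithm does not exist). -/
noncomputable def cumulant {E : Type*} [NormedAddCommGroup E] [InnerProductSpace ℝ E]
    [MeasurableSpace E] (μ : Measure E) : E → ℂ :=
  if hex : ∃ ψ, IsCumulant μ ψ then hex.choose else 0

/-- The price operator `𝒫` from `H³` to `H²` with matrix `[Id 0 Id; 0 Id Id]`. The products carry
the Hilbert sum structure. -/
noncomputable def pricingOperator (H : Type*) [NormedAddCommGroup H] [InnerProductSpace ℝ H] :
    PiLp 2 (fun _ : Fin 3 => H) →L[ℝ] PiLp 2 (fun _ : Fin 2 => H) :=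
  (PiLp.continuousLinearEquiv 2 ℝ (fun _ : Fin 2 => H)).symm.toContinuousLinearMap ∘L
    ContinuousLinearMap.pi
      ![PiLp.proj (𝕜 := ℝ) 2 (fun _ : Fin 3 => H) 0 + PiLp.proj (𝕜 := ℝ) 2 (fun _ : Fin 3 => H) 2,
        PiLp.proj (𝕜 := ℝ) 2 (fun _ : Fin 3 => H) 1 + PiLp.proj (𝕜 := ℝ) 2 (fun _ : Fin 3 => H) 2]

/-- The cointegration operator `[𝒞₁ -𝒞₁]` from `H²` to `C`. -/
noncomputable def cointegrationOperator {H C : Type*} [NormedAddCommGroup H]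
    [InnerProductSpace ℝ H] [NormedAddCommGroup C] [InnerProductSpace ℝ C] (C₁ : H →L[ℝ] C) :
    PiLp 2 (fun _ : Fin 2 => H) →L[ℝ] C :=
  C₁ ∘L PiLp.proj (𝕜 := ℝ) 2 (fun _ : Fin 2 => H) 0 - C₁ ∘L PiLp.proj (𝕜 := ℝ) 2 (fun _ : Fin 2 => H) 1

/-- `(𝒫, 𝒞)` is a cointegration pricing system for the factor process `X`: the process `𝒞 𝒫 X(t)`
admits a limiting distribution (in the sense of weak convergence) as `t → ∞`. -/
def IsCointegrationPricingSystem {Ω E F G : Type*} [MeasurableSpace Ω]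
    [NormedAddCommGroup E] [InnerProductSpace ℝ E] [NormedAddCommGroup F] [InnerProductSpace ℝ F]
    [NormedAddCommGroup G] [InnerProductSpace ℝ G] [MeasurableSpace G] [BorelSpace G]
    (P : Measure Ω) [IsProbabilityMeasure P] (X : ℝ≥0 → Ω → E)
    (A : E →L[ℝ] F) (B : F →L[ℝ] G) : Prop :=
  ∃ (μ : Measure G) (_ : IsProbabilityMeasure μ),
    TendstoInDistribution (fun t ω => B (A (X t ω))) atTop id (fun _ => P) μ

/-! The obstacle is that $\int_0^t \mathcal S(t-s)g_k\,dU_k(s)$ in general has no limit in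
$L^2(\Omega;\mathsf H)$, and in an infinite-dimensional space convergence of characteristic
functions alone does not give weak convergence. Time reversal settles both. The variables
$Y_k(t)=\int_0^t\mathcal S(s)g_k\,dU_k(s)$ do converge in $L^2$, to $Z_k=\int_0^\infty\mathcal
S(s)g_k\,dU_k(s)$, by the Itô isometry. For each fixed $t$, $h_1(t)-h_2(t)+Y_1(t)-Y_2(t)$ has, after
applying $\mathcal C_1$, the same law as $\mathcal C_1(X_1(t)-X_2(t))$, because both cumulants
contain the integral over $[0,t]$ of one function, up to $s\mapsto t-s$. Weak convergence depends
only on the marginal laws, so it passes from $Y$ to $X$.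

The cumulant formula comes from the exponential formula $\mathbb E\,e^{\mathrm
i(Z_1-Z_2,c)}=\exp\int\psi_U((c,f_1),-(c,f_2))\,ds$, where here $Z_k$ integrates a kernel $f_k$. For
step functions it is independence and stationarity of increments (`IsLevyProcess.integral_exp_sum`);
`IsLevyProcess.integral_exp_isWienerIntegral` extends it to $L^2$. The extension rests on the bound
$|\psi(u)-\psi(v)|\le K|u-v|(|u|+|v|)$ of `IsLevyProcess.exists_exponent`, a consequence of zero
mean and finite variance: it makes $a\mapsto\int\psi(a(s))\,ds$ continuous on $L^2$, and also gives
the integrability claim. -/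

set_option linter.unusedSectionVars false

/-! ### Second moments of Lévy processes -/

/-- A nonnegative solution of Cauchy's functional equation on the half line is linear. -/
theorem eq_mul_of_map_add_of_nonneg {v : ℝ≥0 → ℝ} (hadd : ∀ s t, v (s + t) = v s + v t)
    (hnonneg : ∀ t, 0 ≤ v t) (t : ℝ≥0) : v t = t * v 1 := by
  have hmono : Monotone v := fun a b hab => by
    obtain ⟨c, rfl⟩ := exists_add_of_le hab
    rw [hadd]; linarith [hnonneg c]
  have hzero : v 0 = 0 := by simpa using hadd 0 0
  have hnat : ∀ (n : ℕ) (s : ℝ≥0), v (n * s) = n * v s := by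
    intro n s
    induction n with
    | zero => simp [hzero]
    | succ n ih => push_cast; rw [add_mul, hadd, ih, one_mul]; ring
  -- Monotonicity traps `v (n * t)` between the values at the two integers around `n * t`, which
  -- differ by `v 1`; the error in `v t` is thus at most `v 1 / n`.
  have hbound : ∀ n : ℕ, (n : ℝ) * |v t - t * v 1| ≤ v 1 := by
    intro n
    have h1 : (⌊(n : ℝ≥0) * t⌋₊ : ℝ≥0) ≤ n * t := Nat.floor_le zero_le
    have h2 : (n : ℝ≥0) * t ≤ (⌊(n : ℝ≥0) * t⌋₊ + 1 : ℕ) := by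
      push_cast; exact (Nat.lt_floor_add_one _).le
    have h3 := hmono h1
    have h4 := hmono h2
    have e1 := hnat ⌊(n : ℝ≥0) * t⌋₊ 1
    have e2 := hnat (⌊(n : ℝ≥0) * t⌋₊ + 1) 1
    rw [mul_one] at e1 e2
    rw [e1, hnat] at h3
    rw [e2, hnat] at h4
    have h1' : ((⌊(n : ℝ≥0) * t⌋₊ : ℕ) : ℝ) ≤ n * t := by exact_mod_cast h1
    have h2' : (n : ℝ) * t ≤ ((⌊(n : ℝ≥0) * t⌋₊ + 1 : ℕ) : ℝ) := by exact_mod_cast h2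
    have h5 := mul_le_mul_of_nonneg_right h1' (hnonneg 1)
    have h6 := mul_le_mul_of_nonneg_right h2' (hnonneg 1)
    push_cast at h4 h6
    rw [← Nat.abs_cast n, ← abs_mul, abs_le]
    constructor <;> nlinarith
  by_contra hne
  have hpos : 0 < |v t - t * v 1| := abs_pos.2 (sub_ne_zero.2 hne)
  obtain ⟨n, hn⟩ := exists_nat_gt (v 1 / |v t - t * v 1|)
  rw [div_lt_iff₀ hpos] at hn
  exact (hbound n).not_gt hn

theorem MeasureTheory.MemLp.integrable_real_inner {α E : Type*} [MeasurableSpace α] {μ : Measure α}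
    [NormedAddCommGroup E] [InnerProductSpace ℝ E] {f g : α → E} (hf : MemLp f 2 μ)
    (hg : MemLp g 2 μ) : Integrable (fun x => ⟪f x, g x⟫_ℝ) μ :=
  (hf.norm.integrable_mul hg.norm).mono' (hf.1.inner hg.1)
    (Eventually.of_forall fun x => norm_inner_le_norm (f x) (g x))

section Levy

variable {Ω E : Type*} [MeasurableSpace Ω] {P : Measure Ω} [IsProbabilityMeasure P]
  [NormedAddCommGroup E] [InnerProductSpace ℝ E] [CompleteSpace E] [MeasurableSpace E]
  [BorelSpace E] [SecondCountableTopology E] {U : ℝ≥0 → Ω → E}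

namespace IsLevyProcess

theorem indepFun_sub (hU : IsLevyProcess P U) {s t : ℝ≥0} (hst : s ≤ t) :
    IndepFun (U s) (U t - U s) P :=
  hU.indep_increments.indepFun_eval_sub zero_le hst hU.zero

/-- The increment is independent of `U s`, so the expectation of the bilinear form factors into the
means, which vanish. -/
theorem integral_inner_sub (hU : IsLevyProcess P U) (hsq : ∀ t, MemLp (U t) 2 P)
    (hmean : ∀ t, ∫ ω, U t ω ∂P = 0) {s t : ℝ≥0} (hst : s ≤ t) :
    ∫ ω, ⟪U s ω, (U t - U s) ω⟫_ℝ ∂P = 0 := by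
  have hi : ∀ t, Integrable (U t) P := fun t => (hsq t).integrable (by norm_num)
  have := (hU.indepFun_sub hst).integral_bilin (hi s) ((hi t).sub (hi s)) (innerSL ℝ)
  simp only [hmean, map_zero, _root_.zero_apply] at this
  exact this

/-- Orthogonality of increments and stationarity make the second moment additive in time; Cauchy's
equation then forces linearity. -/
theorem integral_norm_sq (hU : IsLevyProcess P U) (hsq : ∀ t, MemLp (U t) 2 P)
    (hmean : ∀ t, ∫ ω, U t ω ∂P = 0) (t : ℝ≥0) :
    ∫ ω, ‖U t ω‖ ^ 2 ∂P = t * ∫ ω, ‖U 1 ω‖ ^ 2 ∂P := by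
  refine eq_mul_of_map_add_of_nonneg (v := fun t => ∫ ω, ‖U t ω‖ ^ 2 ∂P) (fun s t => ?_)
    (fun t => integral_nonneg fun ω => by positivity) t
  have hstat : ∫ ω, ‖U (s + t) ω - U s ω‖ ^ 2 ∂P = ∫ ω, ‖U t ω‖ ^ 2 ∂P :=
    ((hU.stationary_increments s t).comp (u := fun x => ‖x‖ ^ 2) (by fun_prop)).integral_eq
  have hsub : MemLp (U (s + t) - U s) 2 P := (hsq (s + t)).sub (hsq s)
  have hexp : ∀ ω, ‖U (s + t) ω‖ ^ 2 = ‖U s ω‖ ^ 2 + 2 * ⟪U s ω, (U (s + t) - U s) ω⟫_ℝ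
      + ‖U (s + t) ω - U s ω‖ ^ 2 := fun ω => by
    rw [Pi.sub_apply, ← norm_add_sq_real, add_sub_cancel]
  have hcross : Integrable (fun ω => ⟪U s ω, (U (s + t) - U s) ω⟫_ℝ) P :=
    MemLp.integrable_real_inner (hsq s) hsub
  simp only [hexp]
  have hs2 : Integrable (fun ω => ‖U s ω‖ ^ 2) P := (hsq s).integrable_norm_pow (by norm_num)
  have hsub2 : Integrable (fun ω => ‖U (s + t) ω - U s ω‖ ^ 2) P :=
    hsub.integrable_norm_pow (by norm_num)
  have hsum : Integrable (fun ω => ‖U s ω‖ ^ 2 + 2 * ⟪U s ω, (U (s + t) - U s) ω⟫_ℝ) P :=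
    hs2.add (hcross.const_mul 2)
  rw [integral_add hsum hsub2, integral_add hs2 (hcross.const_mul 2), integral_const_mul,
    hU.integral_inner_sub hsq hmean (by simp), hstat]
  ring

theorem integral_inner (hU : IsLevyProcess P U) (hsq : ∀ t, MemLp (U t) 2 P)
    (hmean : ∀ t, ∫ ω, U t ω ∂P = 0) (s t : ℝ≥0) :
    ∫ ω, ⟪U s ω, U t ω⟫_ℝ ∂P = (min s t : ℝ≥0) * ∫ ω, ‖U 1 ω‖ ^ 2 ∂P := by
  wlog hst : s ≤ t generalizing s t
  · rw [min_comm, ← this t s (le_of_not_ge hst)]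
    simp_rw [real_inner_comm]
  rw [min_eq_left hst, ← hU.integral_norm_sq hsq hmean s]
  have hexp : ∀ ω, ⟪U s ω, U t ω⟫_ℝ = ‖U s ω‖ ^ 2 + ⟪U s ω, (U t - U s) ω⟫_ℝ := fun ω => by
    rw [← real_inner_self_eq_norm_sq, ← inner_add_right, Pi.sub_apply, add_sub_cancel]
  simp only [hexp]
  have hs2 : Integrable (fun ω => ‖U s ω‖ ^ 2) P := (hsq s).integrable_norm_pow (by norm_num)
  rw [integral_add hs2
    (MemLp.integrable_real_inner (hsq s) ((hsq t).sub (hsq s))), hU.integral_inner_sub hsq hmean hst,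
    add_zero]

theorem clm_comp {F : Type*} [NormedAddCommGroup F] [NormedSpace ℝ F] [MeasurableSpace F]
    [BorelSpace F] (hU : IsLevyProcess P U) (L : E →L[ℝ] F) :
    IsLevyProcess P (fun t ω => L (U t ω)) where
  zero := by filter_upwards [hU.zero] with ω hω; simp [hω]
  indep_increments := hU.indep_increments.map L
  stationary_increments s t := by
    simpa only [Function.comp_def, map_sub] using
      (hU.stationary_increments s t).comp L.measurable
  stoch_continuous t := by
    -- The added 1 keeps the threshold `ε / (‖L‖ + 1)` meaningful when `L = 0`.
    have hpos : 0 < ‖L‖ + 1 := by positivity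
    refine tendstoInMeasure_iff_norm.2 fun ε hε => ?_
    refine tendsto_of_tendsto_of_tendsto_of_le_of_le tendsto_const_nhds
      (tendstoInMeasure_iff_norm.1 (hU.stoch_continuous t) (ε / (‖L‖ + 1)) (div_pos hε hpos))
      (fun _ => zero_le) fun i => measure_mono fun ω (hω : ε ≤ ‖L (U i ω) - L (U t ω)‖) => ?_
    rw [← map_sub] at hω
    rw [Set.mem_ofPred_eq, div_le_iff₀ hpos]
    nlinarith [L.le_opNorm (U i ω - U t ω), norm_nonneg (U i ω - U t ω)]

end IsLevyProcess

end Levy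

/-- A square integrable real process whose covariance is a multiple of that of Brownian motion. -/
structure HasBrownianCovariance {Ω : Type*} [MeasurableSpace Ω] (P : Measure Ω)
    (V : ℝ≥0 → Ω → ℝ) (κ : ℝ≥0) : Prop where
  memLp : ∀ t, MemLp (V t) 2 P
  integral_mul : ∀ s t, ∫ ω, V s ω * V t ω ∂P = (κ : ℝ) ^ 2 * (min s t : ℝ≥0)

theorem IsLevyProcess.exists_hasBrownianCovariance {Ω : Type*} [MeasurableSpace Ω] {P : Measure Ω}
    [IsProbabilityMeasure P] {V : ℝ≥0 → Ω → ℝ} (hV : IsLevyProcess P V)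
    (hsq : ∀ t, MemLp (V t) 2 P) (hmean : ∀ t, ∫ ω, V t ω ∂P = 0) :
    ∃ κ, HasBrownianCovariance P V κ := by
  -- `κ` is the standard deviation of `V 1`, so that it appears as the factor between norms in the
  -- isometry.
  refine ⟨(√(∫ ω, ‖V 1 ω‖ ^ 2 ∂P)).toNNReal, hsq, fun s t => ?_⟩
  rw [Real.coe_toNNReal _ (Real.sqrt_nonneg _),
    Real.sq_sqrt (integral_nonneg fun _ => by positivity), mul_comm, min_comm]
  exact hV.integral_inner hsq hmean t s

/-! ### The Itô isometry for elementary integrals -/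

section Isometry

variable {Ω H ι : Type*} [MeasurableSpace Ω] {P : Measure Ω} [Fintype ι]
  [NormedAddCommGroup H] [InnerProductSpace ℝ H] {V : ℝ≥0 → Ω → ℝ} {κ : ℝ≥0}

theorem norm_sum_smul_sq (c : ι → ℝ) (x : ι → H) :
    ‖∑ i, c i • x i‖ ^ 2 = ∑ i, ∑ j, c i * c j * ⟪x i, x j⟫_ℝ := by
  rw [← real_inner_self_eq_norm_sq, sum_inner]
  refine Finset.sum_congr rfl fun i _ => ?_
  rw [inner_sum]
  refine Finset.sum_congr rfl fun j _ => ?_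
  rw [real_inner_smul_left, real_inner_smul_right]; ring

theorem memLp_sum_indicator_smul (lo hi : ι → ℝ≥0) (x : ι → H) (p : ℝ≥0∞) :
    MemLp (fun s : ℝ => ∑ i, (Set.Ioc (lo i : ℝ) (hi i)).indicator (fun _ => x i) s) p
      (volume.restrict (Set.Ioi 0)) :=
  memLp_finsetSum _ fun i _ => memLp_indicator_const p measurableSet_Ioc (x i)
    (Or.inr ((Measure.restrict_apply_le _ _).trans_lt measure_Ioc_lt_top).ne)

theorem HasBrownianCovariance.memLp_sum (hV : HasBrownianCovariance P V κ)
    (lo hi : ι → ℝ≥0) (x : ι → H) :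
    MemLp (fun ω => ∑ i, (V (hi i) ω - V (lo i) ω) • x i) 2 P :=
  memLp_finsetSum _ fun i _ =>
    (((ContinuousLinearMap.id ℝ ℝ).smulRight (x i)).comp_memLp'
      ((hV.memLp (hi i)).sub (hV.memLp (lo i))))

/-- The overlap length in terms of minima: exactly the combination produced by expanding the
covariance of two increments. -/
theorem integral_indicator_Ioc_mul (a b c d : ℝ≥0) (hab : a ≤ b) (hcd : c ≤ d) :
    ∫ s in Set.Ioi (0 : ℝ), (Set.Ioc (a : ℝ) b).indicator (fun _ => (1 : ℝ)) s *
      (Set.Ioc (c : ℝ) d).indicator (fun _ => (1 : ℝ)) s =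
      (min b d : ℝ≥0) - (min a d : ℝ≥0) - (min b c : ℝ≥0) + (min a c : ℝ≥0) := by
  have h1 : ∀ s : ℝ, (Set.Ioc (a : ℝ) b).indicator (fun _ => (1 : ℝ)) s *
      (Set.Ioc (c : ℝ) d).indicator (fun _ => (1 : ℝ)) s =
      (Set.Ioc (max a c : ℝ) (min b d)).indicator (fun _ => (1 : ℝ)) s := by
    intro s
    rw [← Set.Ioc_inter_Ioc, ← Set.inter_indicator_mul]
    simp
  simp_rw [h1]
  rw [setIntegral_indicator measurableSet_Ioc, Set.inter_eq_self_of_subset_right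
    (show Set.Ioc (max a c : ℝ) (min b d) ⊆ Set.Ioi 0 from
      fun s hs => lt_of_le_of_lt (le_max_of_le_left a.2) hs.1)]
  simp only [integral_const, smul_eq_mul, mul_one, measureReal_restrict_apply_univ,
    Real.volume_real_Ioc]
  push_cast
  have hab' : (a : ℝ) ≤ b := hab
  have hcd' : (c : ℝ) ≤ d := hcd
  grind

theorem HasBrownianCovariance.integral_increment_mul (hV : HasBrownianCovariance P V κ)
    {a b c d : ℝ≥0} (hab : a ≤ b) (hcd : c ≤ d) :
    ∫ ω, (V b ω - V a ω) * (V d ω - V c ω) ∂P = (κ : ℝ) ^ 2 *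
      ∫ s in Set.Ioi (0 : ℝ), (Set.Ioc (a : ℝ) b).indicator (fun _ => (1 : ℝ)) s *
        (Set.Ioc (c : ℝ) d).indicator (fun _ => (1 : ℝ)) s := by
  have hi : ∀ s t, Integrable (fun ω => V s ω * V t ω) P :=
    fun s t => (hV.memLp s).integrable_mul (hV.memLp t)
  rw [integral_indicator_Ioc_mul a b c d hab hcd]
  have : ∀ ω, (V b ω - V a ω) * (V d ω - V c ω) =
      V b ω * V d ω - V a ω * V d ω - V b ω * V c ω + V a ω * V c ω := fun ω => by ring
  simp_rw [this]
  have h1 : Integrable (fun ω => V b ω * V d ω - V a ω * V d ω) P := (hi _ _).sub (hi _ _)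
  have h2 : Integrable (fun ω => V b ω * V d ω - V a ω * V d ω - V b ω * V c ω) P :=
    h1.sub (hi _ _)
  rw [integral_add h2 (hi _ _), integral_sub h1 (hi _ _), integral_sub (hi _ _) (hi _ _)]
  simp only [hV.integral_mul]
  ring

/-- The Itô isometry for elementary integrals over possibly overlapping intervals. -/
theorem HasBrownianCovariance.integral_norm_sum_sq (hV : HasBrownianCovariance P V κ)
    (lo hi : ι → ℝ≥0) (hle : ∀ i, lo i ≤ hi i) (x : ι → H) :
    ∫ ω, ‖∑ i, (V (hi i) ω - V (lo i) ω) • x i‖ ^ 2 ∂P = (κ : ℝ) ^ 2 *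
      ∫ s in Set.Ioi (0 : ℝ),
        ‖∑ i, (Set.Ioc (lo i : ℝ) (hi i)).indicator (fun _ => x i) s‖ ^ 2 := by
  have hind : ∀ (s : ℝ) i, (Set.Ioc (lo i : ℝ) (hi i)).indicator (fun _ => x i) s =
      (Set.Ioc (lo i : ℝ) (hi i)).indicator (fun _ => (1 : ℝ)) s • x i := by
    intro s i
    by_cases hs : s ∈ Set.Ioc (lo i : ℝ) (hi i) <;> simp [hs]
  simp only [hind, norm_sum_smul_sq]
  have hint : ∀ i j, Integrable (fun ω => (V (hi i) ω - V (lo i) ω) *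
      (V (hi j) ω - V (lo j) ω)) P := fun i j =>
    ((hV.memLp _).sub (hV.memLp _)).integrable_mul ((hV.memLp _).sub (hV.memLp _))
  have hone : ∀ i, MemLp ((Set.Ioc (lo i : ℝ) (hi i)).indicator (fun _ => (1 : ℝ))) 2
      (volume.restrict (Set.Ioi 0)) := fun i =>
    memLp_indicator_const 2 measurableSet_Ioc 1
      (Or.inr ((Measure.restrict_apply_le _ _).trans_lt measure_Ioc_lt_top).ne)
  have hint' : ∀ i j, Integrable (fun s => (Set.Ioc (lo i : ℝ) (hi i)).indicator
      (fun _ => (1 : ℝ)) s * (Set.Ioc (lo j : ℝ) (hi j)).indicator (fun _ => (1 : ℝ)) s)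
      (volume.restrict (Set.Ioi 0)) := fun i j => (hone i).integrable_mul (hone j)
  rw [integral_finsetSum _ fun i _ => integrable_finsetSum _ fun j _ => (hint i j).mul_const _,
    integral_finsetSum _ fun i _ => integrable_finsetSum _ fun j _ => (hint' i j).mul_const _,
    Finset.mul_sum]
  refine Finset.sum_congr rfl fun i _ => ?_
  rw [integral_finsetSum _ fun j _ => (hint i j).mul_const _,
    integral_finsetSum _ fun j _ => (hint' i j).mul_const _, Finset.mul_sum]
  refine Finset.sum_congr rfl fun j _ => ?_
  rw [integral_mul_const, integral_mul_const, hV.integral_increment_mul (hle i) (hle j), mul_assoc]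

theorem eLpNorm_two_eq_ofReal_sqrt {α F : Type*} [MeasurableSpace α] {μ : Measure α}
    [NormedAddCommGroup F] {f : α → F} (hf : MemLp f 2 μ) :
    eLpNorm f 2 μ = ENNReal.ofReal (√(∫ x, ‖f x‖ ^ 2 ∂μ)) := by
  rw [hf.eLpNorm_eq_integral_rpow_norm (by norm_num) (by norm_num), Real.sqrt_eq_rpow]
  simp

theorem HasBrownianCovariance.eLpNorm_sum (hV : HasBrownianCovariance P V κ)
    (lo hi : ι → ℝ≥0) (hle : ∀ i, lo i ≤ hi i) (x : ι → H) :
    eLpNorm (fun ω => ∑ i, (V (hi i) ω - V (lo i) ω) • x i) 2 P = κ *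
      eLpNorm (fun s : ℝ => ∑ i, (Set.Ioc (lo i : ℝ) (hi i)).indicator (fun _ => x i) s) 2
        (volume.restrict (Set.Ioi 0)) := by
  rw [eLpNorm_two_eq_ofReal_sqrt (hV.memLp_sum lo hi x),
    eLpNorm_two_eq_ofReal_sqrt (memLp_sum_indicator_smul lo hi x 2),
    hV.integral_norm_sum_sq lo hi hle x, Real.sqrt_mul (by positivity), Real.sqrt_sq (by positivity),
    ENNReal.ofReal_mul (by positivity), ENNReal.ofReal_coe_nnreal]

end Isometry

section StepFunction

variable {Ω H : Type*} [MeasurableSpace Ω] {P : Measure Ω}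
  [NormedAddCommGroup H] [InnerProductSpace ℝ H] {V : ℝ≥0 → Ω → ℝ} {κ : ℝ≥0}

theorem StepFunction.memLp_eval (φ : StepFunction H) (p : ℝ≥0∞) :
    MemLp φ.eval p (volume.restrict (Set.Ioi 0)) :=
  memLp_sum_indicator_smul φ.lo φ.hi φ.val p

theorem HasBrownianCovariance.memLp_integral (hV : HasBrownianCovariance P V κ)
    (φ : StepFunction H) : MemLp (φ.integral V) 2 P :=
  hV.memLp_sum φ.lo φ.hi φ.val

/-- Since the isometry tolerates overlapping intervals, the two families can simply be concatenated,
the second with negated values; no common refinement is needed. -/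
theorem HasBrownianCovariance.eLpNorm_integral_sub (hV : HasBrownianCovariance P V κ)
    (φ χ : StepFunction H) :
    eLpNorm (φ.integral V - χ.integral V) 2 P =
      κ * eLpNorm (φ.eval - χ.eval) 2 (volume.restrict (Set.Ioi 0)) := by
  have key := hV.eLpNorm_sum (Sum.elim φ.lo χ.lo) (Sum.elim φ.hi χ.hi)
    (by rintro (i | i); exacts [φ.lo_le_hi i, χ.lo_le_hi i]) (Sum.elim φ.val (-χ.val))
  convert key using 2
  · ext ω
    simp [StepFunction.integral, sub_eq_add_neg]
  · congr 1
    ext s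
    simp only [StepFunction.eval, Pi.sub_apply, Fintype.sum_sum_type, Sum.elim_inl, Sum.elim_inr,
      Pi.neg_apply, sub_eq_add_neg, ← Finset.sum_neg_distrib]
    congr 1
    refine Finset.sum_congr rfl fun i _ => ?_
    by_cases hs : s ∈ Set.Ioc (χ.lo i : ℝ) (χ.hi i) <;> simp [hs]

end StepFunction

/-! ### Density of step functions in $L^2(\mathbb R_+;\mathsf H)$ -/

section Density

variable {H : Type*} [NormedAddCommGroup H]

/-- The step function taking the value `f (i / n)` on `(i / n, (i + 1) / n]` for `i < n * N`. -/
noncomputable def StepFunction.grid (f : ℝ → H) (n N : ℕ) : StepFunction H where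
  n := n * N
  lo i := (i : ℝ≥0) / n
  hi i := ((i : ℝ≥0) + 1) / n
  lo_le_hi i := by gcongr; simp
  val i := f ((i : ℝ) / n)

theorem StepFunction.grid_eval (f : ℝ → H) {n N : ℕ} (hn : 0 < n) {s : ℝ}
    (hs : s ∈ Set.Ioc (0 : ℝ) N) :
    ∃ r, |s - r| ≤ 1 / n ∧ (StepFunction.grid f n N).eval s = f r := by
  have hn' : (0 : ℝ) < n := by exact_mod_cast hn
  have hpos : 0 < ⌈s * n⌉₊ := Nat.ceil_pos.2 (mul_pos hs.1 hn')
  have hle : ⌈s * n⌉₊ ≤ n * N := Nat.ceil_le.2 (by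
    push_cast; rw [mul_comm]; exact mul_le_mul_of_nonneg_left hs.2 hn'.le)
  -- The cells are open on the left and closed on the right, so `s` lies in the cell of index `⌈s *
  -- n⌉₊ - 1`.
  obtain ⟨k, hk⟩ := Nat.exists_eq_add_of_lt hpos
  simp only [zero_add] at hk
  have h1 : s * n ≤ k + 1 := by exact_mod_cast hk ▸ Nat.le_ceil (s * n)
  have h2 : (k : ℝ) < s * n := Nat.lt_ceil.1 (by omega)
  refine ⟨k / n, ?_, ?_⟩
  · rw [abs_le]
    constructor
    · have : (k : ℝ) / n ≤ s := by rw [div_le_iff₀ hn']; exact h2.le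
      have : 0 < 1 / (n : ℝ) := by positivity
      linarith
    · have : s ≤ (k + 1) / n := by rw [le_div_iff₀ hn']; exact h1
      rw [add_div] at this
      linarith
  · have hmem : ∀ i : Fin (n * N), s ∈ Set.Ioc ((((i : ℕ) : ℝ≥0) / n : ℝ≥0) : ℝ)
        ((((i : ℕ) : ℝ≥0) + 1) / n : ℝ≥0) ↔ (i : ℕ) = k := by
      intro i
      push_cast
      rw [Set.mem_Ioc, div_lt_iff₀ hn', le_div_iff₀ hn']
      constructor
      · rintro ⟨h3, h4⟩
        have h5 : (i : ℝ) < k + 1 := h3.trans_le h1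
        have h6 : (k : ℝ) < i + 1 := h2.trans_le h4
        have h5' : (i : ℕ) < k + 1 := by exact_mod_cast h5
        have h6' : k < (i : ℕ) + 1 := by exact_mod_cast h6
        omega
      · rintro h3
        rw [h3]
        exact ⟨h2, h1⟩
    change ∑ i : Fin (n * N), _ = _
    rw [Finset.sum_eq_single (⟨k, by omega⟩ : Fin (n * N))]
    · exact Set.indicator_of_mem ((hmem _).2 rfl) _
    · intro i _ hi
      exact Set.indicator_of_notMem (fun h => hi (Fin.ext ((hmem i).1 h))) _
    · simp

theorem StepFunction.grid_eval_of_lt (f : ℝ → H) {n N : ℕ} {s : ℝ} (hs : (N : ℝ) < s) :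
    (StepFunction.grid f n N).eval s = 0 := by
  refine Finset.sum_eq_zero fun i _ => Set.indicator_of_notMem (fun h => ?_) _
  have hi : (i : ℕ) < n * N := i.2
  have hn : 0 < n := Nat.pos_of_mul_pos_right (by omega : 0 < n * N)
  have hn' : (0 : ℝ) < n := by exact_mod_cast hn
  have h2 : s ≤ ((i : ℕ) + 1 : ℝ) / n := by simpa [StepFunction.grid] using h.2
  rw [le_div_iff₀ hn'] at h2
  have h3 : ((i : ℕ) + 1 : ℝ) ≤ n * N := by exact_mod_cast hi
  nlinarith

theorem exists_stepFunction_eLpNorm_sub_le_of_continuous {f : ℝ → H} (hf : Continuous f)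
    (hsupp : HasCompactSupport f) {ε : ℝ≥0∞} (hε : ε ≠ 0) :
    ∃ φ : StepFunction H, eLpNorm (f - φ.eval) 2 (volume.restrict (Set.Ioi 0)) ≤ ε := by
  obtain ⟨N, hN⟩ : ∃ N : ℕ, ∀ s : ℝ, (N : ℝ) < s → f s = 0 := by
    obtain ⟨R, hR⟩ := hsupp.isCompact.isBounded.subset_closedBall 0
    obtain ⟨N, hN⟩ := exists_nat_gt R
    refine ⟨N, fun s hs => image_eq_zero_of_notMem_tsupport fun h => ?_⟩
    have := hR h
    rw [mem_closedBall_zero_iff, Real.norm_eq_abs] at this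
    linarith [le_abs_self s]
  have huc := hf.uniformContinuous_of_tendsto_cocompact hsupp.is_zero_at_infty
  -- A uniform error `δ` on an interval of length `N` costs `δ * √N` in the $L^2$ norm.
  obtain ⟨δ, hδ, hδε⟩ : ∃ δ : ℝ, 0 < δ ∧
      ENNReal.ofReal δ * (N : ℝ≥0∞) ^ (1 / (2 : ℝ)) ≤ ε := by
    obtain ⟨δ, hδ, hδε⟩ := ENNReal.exists_nnreal_pos_mul_lt
      (a := (N : ℝ≥0∞) ^ (1 / (2 : ℝ))) (by finiteness) hε
    exact ⟨δ, hδ, by simpa using hδε.le⟩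
  obtain ⟨η, hη, hfη⟩ := Metric.uniformContinuous_iff.1 huc δ hδ
  obtain ⟨n, hn⟩ := exists_nat_one_div_lt hη
  refine ⟨StepFunction.grid f (n + 1) N, ?_⟩
  have hzero : ∀ s ∈ Set.Ioi (0 : ℝ), (f - (StepFunction.grid f (n + 1) N).eval) s =
      (Set.Ioc (0 : ℝ) N).indicator (f - (StepFunction.grid f (n + 1) N).eval) s := by
    intro s hs
    by_cases hsN : s ≤ N
    · rw [Set.indicator_of_mem (show s ∈ Set.Ioc (0 : ℝ) N from ⟨hs, hsN⟩)]
    · rw [Set.indicator_of_notMem (fun h => hsN h.2), Pi.sub_apply,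
        StepFunction.grid_eval_of_lt f (not_le.1 hsN), hN s (not_le.1 hsN), sub_zero]
  rw [eLpNorm_congr_ae ((ae_restrict_iff' measurableSet_Ioi).2 (Eventually.of_forall hzero)),
    eLpNorm_indicator_eq_eLpNorm_restrict measurableSet_Ioc,
    Measure.restrict_restrict_of_subset (fun s hs => hs.1)]
  refine (eLpNorm_le_of_ae_bound (C := δ) ?_).trans (le_trans (le_of_eq ?_) hδε)
  · refine (ae_restrict_iff' measurableSet_Ioc).2 (Eventually.of_forall fun s hs => ?_)
    obtain ⟨r, hr, hφ⟩ := StepFunction.grid_eval f (Nat.succ_pos n) hs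
    rw [Pi.sub_apply, hφ, ← dist_eq_norm]
    exact (hfη (lt_of_le_of_lt (by simpa [Real.dist_eq] using hr) hn)).le
  · rw [Measure.restrict_apply_univ, Real.volume_Ioc, mul_comm]
    simp

theorem exists_stepFunction_eLpNorm_sub_le [InnerProductSpace ℝ H] {f : ℝ → H}
    (hf : MemLp f 2 (volume.restrict (Set.Ioi 0))) {ε : ℝ≥0∞} (hε : ε ≠ 0) :
    ∃ φ : StepFunction H, eLpNorm (f - φ.eval) 2 (volume.restrict (Set.Ioi 0)) ≤ ε := by
  have hε2 : ε / 2 ≠ 0 := (ENNReal.half_pos hε).ne'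
  -- Extending `f` by zero to the whole line allows approximation by compactly supported continuous
  -- functions, which are then sampled on a grid.
  obtain ⟨g, hg_supp, hg_le, hg_cont, hg_mem⟩ :=
    ((memLp_indicator_iff_restrict measurableSet_Ioi).2 hf).exists_hasCompactSupport_eLpNorm_sub_le
      (by norm_num) hε2
  obtain ⟨φ, hφ⟩ := exists_stepFunction_eLpNorm_sub_le_of_continuous hg_cont hg_supp hε2
  refine ⟨φ, ?_⟩
  have h1 : eLpNorm (f - g) 2 (volume.restrict (Set.Ioi 0)) ≤ ε / 2 := by
    refine le_trans ?_ ((eLpNorm_mono_measure (ν := volume.restrict (Set.Ioi 0)) _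
      Measure.restrict_le_self).trans hg_le)
    refine le_of_eq (eLpNorm_congr_ae ((ae_restrict_iff' measurableSet_Ioi).2
      (Eventually.of_forall fun s hs => ?_)))
    simp only [Pi.sub_apply, Set.indicator_of_mem hs]
  calc eLpNorm (f - φ.eval) 2 (volume.restrict (Set.Ioi 0))
      = eLpNorm ((f - g) + (g - φ.eval)) 2 (volume.restrict (Set.Ioi 0)) := by
        rw [sub_add_sub_cancel]
    _ ≤ _ := eLpNorm_add_le (hf.1.sub hg_mem.1.restrict)
        (hg_mem.1.restrict.sub (φ.memLp_eval 2).1) (by norm_num)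
    _ ≤ ε / 2 + ε / 2 := add_le_add h1 hφ
    _ = ε := ENNReal.add_halves ε

end Density

/-! ### Stochastic integrals of deterministic integrands -/

section WienerIntegral

variable {Ω H : Type*} [MeasurableSpace Ω] {P : Measure Ω}
  [NormedAddCommGroup H] [InnerProductSpace ℝ H] {V : ℝ≥0 → Ω → ℝ} {κ : ℝ≥0}

/-- `Z` is a version of the stochastic integral `∫₀^∞ f dV` of a deterministic integrand. -/
def IsWienerIntegral (P : Measure Ω) (V : ℝ≥0 → Ω → ℝ) (f : ℝ → H) (Z : Ω → H) : Prop :=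
  MemLp f 2 (volume.restrict (Set.Ioi (0 : ℝ))) ∧ MemLp Z 2 P ∧
    ∃ φ : ℕ → StepFunction H,
      Tendsto (fun m => eLpNorm (f - (φ m).eval) 2 (volume.restrict (Set.Ioi (0 : ℝ))))
        atTop (𝓝 0) ∧
      Tendsto (fun m => eLpNorm (Z - (φ m).integral V) 2 P) atTop (𝓝 0)

/-- The isometry turns approximating step functions into a Cauchy sequence of elementary integrals,
and $L^2(\Omega;\mathsf H)$ is complete. The antitone bound `b` supplies a Cauchy modulus. -/
theorem HasBrownianCovariance.exists_tendsto_integral [CompleteSpace H]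
    (hV : HasBrownianCovariance P V κ)
    {f : ℝ → H} (hf : MemLp f 2 (volume.restrict (Set.Ioi (0 : ℝ)))) {φ : ℕ → StepFunction H}
    {b : ℕ → ℝ≥0∞} (hb : Antitone b) (hb0 : Tendsto b atTop (𝓝 0))
    (hφ : ∀ m, eLpNorm (f - (φ m).eval) 2 (volume.restrict (Set.Ioi (0 : ℝ))) ≤ b m) :
    ∃ Z, MemLp Z 2 P ∧ Tendsto (fun m => eLpNorm (Z - (φ m).integral V) 2 P) atTop (𝓝 0) := by
  have hcauchy : CauchySeq fun m => (hV.memLp_integral (φ m)).toLp ((φ m).integral V) := by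
    refine EMetric.cauchySeq_iff_le_tendsto_0.2 ⟨fun N => κ * (b N + b N), fun n m N hn hm => ?_, ?_⟩
    · rw [Lp.edist_toLp_toLp, hV.eLpNorm_integral_sub]
      refine mul_le_mul_right ?_ _
      calc _ = eLpNorm ((f - (φ m).eval) - (f - (φ n).eval)) 2 (volume.restrict (Set.Ioi (0 : ℝ))) := by
            rw [sub_sub_sub_cancel_left]
        _ ≤ _ := eLpNorm_sub_le (hf.1.sub ((φ m).memLp_eval 2).1)
            (hf.1.sub ((φ n).memLp_eval 2).1) (by norm_num)
        _ ≤ _ := add_le_add ((hφ m).trans (hb hm)) ((hφ n).trans (hb hn))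
    · simpa using ENNReal.Tendsto.const_mul (hb0.add hb0) (Or.inr ENNReal.coe_ne_top)
  obtain ⟨Z, hZ⟩ := cauchySeq_tendsto_of_complete hcauchy
  refine ⟨Z, Lp.memLp Z, ?_⟩
  rw [tendsto_iff_edist_tendsto_0] at hZ
  refine hZ.congr fun m => ?_
  rw [edist_comm, Lp.edist_def]
  refine eLpNorm_congr_ae ?_
  filter_upwards [(hV.memLp_integral (φ m)).coeFn_toLp] with ω hω
  simp [hω]

theorem HasBrownianCovariance.exists_isWienerIntegral [CompleteSpace H]
    (hV : HasBrownianCovariance P V κ) {f : ℝ → H}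
    (hf : MemLp f 2 (volume.restrict (Set.Ioi (0 : ℝ)))) : ∃ Z, IsWienerIntegral P V f Z := by
  -- The tolerance is `⊤` at `m = 0`, hence nonzero for every `m`.
  choose φ hφ using fun m : ℕ => exists_stepFunction_eLpNorm_sub_le hf
    (ε := ((m : ℝ≥0∞))⁻¹) (by simp)
  have hb0 : Tendsto (fun m : ℕ => ((m : ℝ≥0∞))⁻¹) atTop (𝓝 0) :=
    ENNReal.tendsto_inv_nat_nhds_zero
  obtain ⟨Z, hZ, hlim⟩ := hV.exists_tendsto_integral hf
    (fun a b hab => by simpa using hab) hb0 hφ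
  exact ⟨Z, hf, hZ, φ, tendsto_of_tendsto_of_tendsto_of_le_of_le tendsto_const_nhds hb0
    (fun _ => zero_le) hφ, hlim⟩

/-- The restriction of a step function to `(0, t]`. -/
noncomputable def StepFunction.truncate (φ : StepFunction H) (t : ℝ≥0) : StepFunction H where
  n := φ.n
  lo i := min (φ.lo i) t
  hi i := min (φ.hi i) t
  lo_le_hi i := min_le_min_right t (φ.lo_le_hi i)
  val := φ.val

theorem StepFunction.truncate_eval (φ : StepFunction H) (t : ℝ≥0) {s : ℝ} :
    (φ.truncate t).eval s = (Set.Iic (t : ℝ)).indicator φ.eval s := by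
  by_cases hs : s ≤ t
  · rw [Set.indicator_of_mem (s := Set.Iic (t : ℝ)) hs]
    refine Finset.sum_congr rfl fun i _ => ?_
    refine Set.indicator_eq_indicator ?_ rfl
    simp only [StepFunction.truncate, Set.mem_Ioc, NNReal.coe_min]
    grind
  · rw [Set.indicator_of_notMem (s := Set.Iic (t : ℝ)) hs]
    refine Finset.sum_eq_zero fun i _ => Set.indicator_of_notMem (fun h => hs ?_) _
    exact h.2.trans (by exact_mod_cast min_le_right _ _)

theorem StepFunction.eval_eq_zero_of_lt {φ : StepFunction H} {t : ℝ≥0} (hφ : ∀ i, φ.hi i ≤ t)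
    {s : ℝ} (hs : (t : ℝ) < s) : φ.eval s = 0 :=
  Finset.sum_eq_zero fun i _ => Set.indicator_of_notMem
    (fun h => (hs.trans_le h.2).not_ge (by exact_mod_cast hφ i)) _

theorem eLpNorm_indicator_sub_eval (f : ℝ → H) {φ : StepFunction H} {t : ℝ≥0}
    (hφ : ∀ i, φ.hi i ≤ t) :
    eLpNorm ((Set.Ioc (0 : ℝ) t).indicator f - φ.eval) 2 (volume.restrict (Set.Ioi 0)) =
      eLpNorm (fun s => f s - φ.eval s) 2 (volume.restrict (Set.Ioc 0 t)) := by
  have : ∀ s ∈ Set.Ioi (0 : ℝ), ((Set.Ioc (0 : ℝ) t).indicator f - φ.eval) s =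
      (Set.Ioc (0 : ℝ) t).indicator (fun s => f s - φ.eval s) s := by
    intro s hs
    by_cases hst : s ≤ t
    · simp only [Pi.sub_apply, Set.indicator_of_mem (show s ∈ Set.Ioc (0 : ℝ) t from ⟨hs, hst⟩)]
    · simp only [Pi.sub_apply, Set.indicator_of_notMem (show s ∉ Set.Ioc (0 : ℝ) t from
        fun h => hst h.2), StepFunction.eval_eq_zero_of_lt hφ (not_le.1 hst), sub_zero]
  rw [eLpNorm_congr_ae ((ae_restrict_iff' measurableSet_Ioi).2 (Eventually.of_forall this)),
    eLpNorm_indicator_eq_eLpNorm_restrict measurableSet_Ioc,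
    Measure.restrict_restrict_of_subset (fun s hs => hs.1)]

theorem memLp_indicator_Ioc {f : ℝ → H} {t : ℝ≥0}
    (hf : MemLp f 2 (volume.restrict (Set.Ioc (0 : ℝ) t))) :
    MemLp ((Set.Ioc (0 : ℝ) t).indicator f) 2 (volume.restrict (Set.Ioi 0)) := by
  rw [memLp_indicator_iff_restrict measurableSet_Ioc,
    Measure.restrict_restrict_of_subset (fun s hs => hs.1)]
  exact hf

/-- Integrals over `(0, t]` become half-line integrals of integrands cut off at `t`, so that
different horizons can be compared in one space. -/
theorem IsStochIntegral.isWienerIntegral {f : ℝ → H} {t : ℝ≥0} {Z : Ω → H}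
    (h : IsStochIntegral P V f t Z) :
    IsWienerIntegral P V ((Set.Ioc (0 : ℝ) t).indicator f) Z := by
  obtain ⟨hf, hZ, φ, hφ, hlim, hlim'⟩ := h
  refine ⟨memLp_indicator_Ioc hf, hZ, φ, ?_, hlim'⟩
  simpa only [eLpNorm_indicator_sub_eval f (hφ _)] using hlim

theorem HasBrownianCovariance.exists_isStochIntegral [CompleteSpace H]
    (hV : HasBrownianCovariance P V κ) {f : ℝ → H} {t : ℝ≥0}
    (hf : MemLp f 2 (volume.restrict (Set.Ioc (0 : ℝ) t))) : ∃ Z, IsStochIntegral P V f t Z := by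
  choose φ hφ using fun m : ℕ => exists_stepFunction_eLpNorm_sub_le (memLp_indicator_Ioc hf)
    (ε := ((m : ℝ≥0∞))⁻¹) (by simp)
  have hhi : ∀ m i, ((φ m).truncate t).hi i ≤ t := fun m i => min_le_right _ _
  -- The target vanishes beyond `t`, so truncating the step function can only decrease the error.
  have hφ' : ∀ m, eLpNorm ((Set.Ioc (0 : ℝ) t).indicator f - ((φ m).truncate t).eval) 2
      (volume.restrict (Set.Ioi 0)) ≤ ((m : ℝ≥0∞))⁻¹ := by
    refine fun m => le_trans (eLpNorm_mono fun s => ?_) (hφ m)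
    rw [Pi.sub_apply, Pi.sub_apply, StepFunction.truncate_eval]
    by_cases hs : s ≤ t
    · rw [Set.indicator_of_mem (s := Set.Iic (t : ℝ)) hs]
    · rw [Set.indicator_of_notMem (s := Set.Iic (t : ℝ)) hs,
        Set.indicator_of_notMem (s := Set.Ioc (0 : ℝ) t) fun h => hs h.2]
      simp
  have hb0 : Tendsto (fun m : ℕ => ((m : ℝ≥0∞))⁻¹) atTop (𝓝 0) :=
    ENNReal.tendsto_inv_nat_nhds_zero
  obtain ⟨Z, hZ, hlim⟩ := hV.exists_tendsto_integral (memLp_indicator_Ioc hf)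
    (fun a b hab => by simpa using hab) hb0 hφ'
  refine ⟨Z, hf, hZ, fun m => (φ m).truncate t, hhi, ?_, hlim⟩
  simp only [← eLpNorm_indicator_sub_eval f (hhi _)]
  exact tendsto_of_tendsto_of_tendsto_of_le_of_le tendsto_const_nhds hb0
    (fun _ => zero_le) hφ'

/-- The isometry for step functions passes to the limit, whichever approximating sequences define
the two versions. It later gives convergence of the truncated integrals to the full one. -/
theorem HasBrownianCovariance.eLpNorm_isWienerIntegral_sub_le
    (hV : HasBrownianCovariance P V κ) {f f' : ℝ → H}
    {Z Z' : Ω → H} (h : IsWienerIntegral P V f Z) (h' : IsWienerIntegral P V f' Z') :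
    eLpNorm (Z - Z') 2 P ≤ κ * eLpNorm (f - f') 2 (volume.restrict (Set.Ioi (0 : ℝ))) := by
  obtain ⟨hf, hZ, φ, hφ, hlim⟩ := h
  obtain ⟨hf', hZ', χ, hχ, hlim'⟩ := h'
  have hbound : ∀ m, eLpNorm (Z - Z') 2 P ≤
      eLpNorm (Z - (φ m).integral V) 2 P + κ * (eLpNorm (f - (φ m).eval) 2
        (volume.restrict (Set.Ioi (0 : ℝ))) + (eLpNorm (f - f') 2
        (volume.restrict (Set.Ioi (0 : ℝ))) + eLpNorm (f' - (χ m).eval) 2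
        (volume.restrict (Set.Ioi (0 : ℝ))))) + eLpNorm (Z' - (χ m).integral V) 2 P := by
    intro m
    have hφm := hV.memLp_integral (φ m)
    have hχm := hV.memLp_integral (χ m)
    have e1 : Z - Z' = (Z - (φ m).integral V) + ((φ m).integral V - (χ m).integral V)
        - (Z' - (χ m).integral V) := by abel
    have e2 : (φ m).eval - (χ m).eval = ((f - f') + (f' - (χ m).eval)) - (f - (φ m).eval) := by abel
    have hfm := (φ m).memLp_eval 2
    have hfm' := (χ m).memLp_eval 2
    have h2 : (1 : ℝ≥0∞) ≤ 2 := by norm_num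
    rw [e1]
    refine (eLpNorm_sub_le ((hZ.sub hφm).add (hφm.sub hχm)).1 (hZ'.sub hχm).1 h2).trans ?_
    gcongr
    refine (eLpNorm_add_le (hZ.sub hφm).1 (hφm.sub hχm).1 h2).trans ?_
    gcongr
    rw [hV.eLpNorm_integral_sub]
    gcongr
    rw [e2, add_comm (eLpNorm (f - (φ m).eval) 2 _)]
    refine (eLpNorm_sub_le ((hf.sub hf').add (hf'.sub hfm')).1 (hf.sub hfm).1 h2).trans ?_
    gcongr
    exact eLpNorm_add_le (hf.sub hf').1 (hf'.sub hfm').1 h2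
  refine ge_of_tendsto' (x := atTop) ?_ hbound
  have := (hlim.add (ENNReal.Tendsto.const_mul (a := (κ : ℝ≥0∞)) (hφ.add ((tendsto_const_nhds
    (x := eLpNorm (f - f') 2 (volume.restrict (Set.Ioi (0 : ℝ))))).add hχ))
    (Or.inr ENNReal.coe_ne_top))).add hlim'
  simpa using this

end WienerIntegral

/-! ### The Lévy exponent and its quadratic bound -/

/-- A Lipschitz multiplicative semigroup of contractions of `ℂ` is exponential. -/
theorem exists_eq_exp_of_map_add {f : ℝ≥0 → ℂ} (hadd : ∀ s t, f (s + t) = f s * f t)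
    (hle : ∀ t, ‖f t‖ ≤ 1) {C : ℝ≥0} (hC : ∀ t, ‖f t - 1‖ ≤ C * t) :
    ∃ z : ℂ, ∀ t : ℝ≥0, f t = Complex.exp (t * z) := by
  have hzero : f 0 = 1 := by simpa [sub_eq_zero] using hC 0
  have hlip : LipschitzWith C f := by
    refine LipschitzWith.of_dist_le_mul fun s t => ?_
    wlog hst : s ≤ t generalizing s t
    · rw [dist_comm, dist_comm s]; exact this t s (le_of_not_ge hst)
    obtain ⟨r, rfl⟩ := exists_add_of_le hst
    have e : f s - f (s + r) = -(f s * (f r - 1)) := by rw [hadd]; ring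
    have hd : dist s (s + r) = r := by
      rw [NNReal.dist_eq]; push_cast; rw [sub_add_cancel_left, abs_neg, NNReal.abs_eq]
    rw [dist_eq_norm, e, norm_neg, norm_mul, hd]
    calc ‖f s‖ * ‖f r - 1‖ ≤ 1 * (C * r) := by
          gcongr
          exacts [hle s, hC r]
      _ = C * r := one_mul _
  set φ : ℝ → ℂ := fun x => f x.toNNReal with hφ
  have hφc : Continuous φ := hlip.continuous.comp continuous_real_toNNReal
  have hφadd : ∀ s t : ℝ, 0 ≤ s → 0 ≤ t → φ (s + t) = φ s * φ t := fun s t hs ht => by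
    simp only [hφ, Real.toNNReal_add hs ht, hadd]
  -- Smoothing by integration: `φ t * F a = F (t + a) - F t` shows that the merely Lipschitz `φ` is
  -- differentiable, once some `F a` is nonzero.
  set F : ℝ → ℂ := fun x => ∫ s in (0 : ℝ)..x, φ s with hF
  have hFd : ∀ x, HasDerivAt F (φ x) x := fun x =>
    intervalIntegral.integral_hasDerivAt_right (hφc.intervalIntegrable _ _)
      (hφc.stronglyMeasurableAtFilter _ _) hφc.continuousAt
  -- `F` vanishes at 0 with derivative `φ 0 = 1`, so it is nonzero just to the right of 0.
  obtain ⟨a, haF, ha⟩ : ∃ a, F a ≠ 0 ∧ 0 < a := by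
    have h0 : φ 0 ≠ 0 := by simp [hφ, hzero]
    have := (hFd 0).eventually_ne (c := (0 : ℂ)) h0
    have h1 : ∀ᶠ x in 𝓝[>] (0 : ℝ), F x ≠ 0 :=
      this.filter_mono (nhdsWithin_mono _ fun x hx => ne_of_gt hx)
    exact (h1.and self_mem_nhdsWithin).exists
  have hrep : ∀ t, 0 ≤ t → φ t = (F (t + a) - F t) / F a := by
    intro t ht
    rw [eq_div_iff haF]
    have h1 : φ t * F a = ∫ s in (0 : ℝ)..a, φ (t + s) := by
      rw [hF, ← intervalIntegral.integral_const_mul]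
      refine intervalIntegral.integral_congr fun s hs => ?_
      rw [Set.uIcc_of_le ha.le] at hs
      exact (hφadd t s ht hs.1).symm
    rw [h1, intervalIntegral.integral_comp_add_left, add_zero,
      intervalIntegral.integral_interval_sub_left (hφc.intervalIntegrable _ _)
        (hφc.intervalIntegrable _ _)]
  set z : ℂ := (φ a - 1) / F a with hz
  have hderiv : ∀ x, 0 ≤ x → HasDerivWithinAt φ (φ x * z) (Set.Ici x) x := by
    intro x hx
    have h1 : HasDerivAt (fun t => (F (t + a) - F t) / F a) ((φ (x + a) - φ x) / F a) x :=
      (((hFd (x + a)).comp_add_const x a).sub (hFd x)).div_const _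
    have h2 : (φ (x + a) - φ x) / F a = φ x * z := by
      rw [hφadd x a hx ha.le, hz]; ring
    rw [h2] at h1
    exact h1.hasDerivWithinAt.congr (fun t ht => hrep t (hx.trans ht)) (hrep x hx)
  refine ⟨z, fun t => ?_⟩
  have hexp : ∀ x : ℝ, HasDerivAt (fun y : ℝ => Complex.exp (-(y * z)))
      (Complex.exp (-(x * z)) * -z) x := fun x => by
    have := (((Complex.ofRealCLM.hasDerivAt (x := x)).mul_const z).neg).cexp
    simpa using this
  -- The semigroup law holds only for nonnegative times, so only right derivatives are available;
  -- vanishing right derivative and continuity suffice.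
  have hconst := constant_of_has_deriv_right_zero (a := 0) (b := (t : ℝ))
    (f := fun x : ℝ => φ x * Complex.exp (-(x * z))) (by fun_prop)
    (fun x hx => by
      have := (hderiv x hx.1).mul (hexp x).hasDerivWithinAt
      refine this.congr_deriv ?_
      ring) t ⟨t.2, le_rfl⟩
  simp only [hφ, Real.toNNReal_coe, Real.toNNReal_zero, hzero, Complex.ofReal_zero, zero_mul,
    neg_zero, Complex.exp_zero, mul_one] at hconst
  rw [Complex.exp_neg] at hconst
  field_simp at hconst
  exact hconst

/-- Two cumulants are lifts of one map through the covering `exp : ℂ → ℂ \ {0}`; they agree at 0 and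
the domain is connected. -/
theorem IsCumulant.unique {E : Type*} [NormedAddCommGroup E] [InnerProductSpace ℝ E]
    [MeasurableSpace E] {μ : Measure E} {ψ χ : E → ℂ} (hψ : IsCumulant μ ψ)
    (hχ : IsCumulant μ χ) : ψ = χ :=
  Complex.isCoveringMap_exp.eq_of_comp_eq hψ.1 hχ.1
    (funext fun u => Subtype.ext ((hψ.2.2 u).trans (hχ.2.2 u).symm)) 0 (hψ.2.1.trans hχ.2.1.symm)

theorem IsCumulant.isCumulant_cumulant {E : Type*} [NormedAddCommGroup E] [InnerProductSpace ℝ E]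
    [MeasurableSpace E] {μ : Measure E} {ψ : E → ℂ} (hψ : IsCumulant μ ψ) :
    IsCumulant μ (cumulant μ) := by
  have hex : ∃ ψ, IsCumulant μ ψ := ⟨ψ, hψ⟩
  rw [cumulant, dif_pos hex]
  exact hex.choose_spec

theorem IsCumulant.cumulant_eq {E : Type*} [NormedAddCommGroup E] [InnerProductSpace ℝ E]
    [MeasurableSpace E] {μ : Measure E} {ψ : E → ℂ} (hψ : IsCumulant μ ψ) : cumulant μ = ψ :=
  hψ.isCumulant_cumulant.unique hψ

/-- Mean value inequality for $e^{\mathrm ix}-\mathrm ix$, whose derivative has modulus at most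
$|x|\le|a|+|b|$ between `b` and `a`. -/
theorem norm_exp_mul_I_sub_sub_le (a b : ℝ) :
    ‖Complex.exp (a * Complex.I) - Complex.exp (b * Complex.I) - (a - b) * Complex.I‖ ≤
      (|a| + |b|) * |a - b| := by
  have hderiv : ∀ x : ℝ, HasDerivAt (fun x : ℝ => Complex.exp (x * Complex.I) - x * Complex.I)
      (Complex.exp (x * Complex.I) * Complex.I - Complex.I) x := fun x => by
    have h := (Complex.ofRealCLM.hasDerivAt (x := x)).mul_const Complex.I
    simpa [Pi.sub_def] using h.cexp.sub h
  have hbound : ∀ x ∈ Set.uIcc b a,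
      ‖Complex.exp (x * Complex.I) * Complex.I - Complex.I‖ ≤ |a| + |b| := by
    intro x hx
    have e : Complex.exp (x * Complex.I) * Complex.I - Complex.I =
        (Complex.exp (Complex.I * x) - 1) * Complex.I := by rw [mul_comm (x : ℂ)]; ring
    rw [e, norm_mul, Complex.norm_I, mul_one]
    refine (Real.norm_exp_I_mul_ofReal_sub_one_le).trans ?_
    rw [Real.norm_eq_abs]
    rw [Set.mem_uIcc] at hx
    grind
  have := (convex_uIcc b a).norm_image_sub_le_of_norm_hasDerivWithin_le
    (fun x _ => (hderiv x).hasDerivWithinAt) hbound Set.left_mem_uIcc Set.right_mem_uIcc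
  refine le_trans (le_of_eq ?_) this
  congr 1
  ring

section Levy

variable {Ω E : Type*} [MeasurableSpace Ω] {P : Measure Ω} [IsProbabilityMeasure P]
  [NormedAddCommGroup E] [InnerProductSpace ℝ E] [MeasurableSpace E]
  [BorelSpace E] [SecondCountableTopology E]

theorem charFun_map_eq_integral {X : Ω → E} (hX : AEMeasurable X P) (u : E) :
    charFun (P.map X) u = ∫ ω, Complex.exp (⟪X ω, u⟫_ℝ * Complex.I) ∂P := by
  rw [charFun_apply, integral_map hX (by fun_prop)]

/-- Zero mean allows the linear term to be subtracted at no cost, which leaves an error quadratic in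
`X`. For `X = U t` the constant is then proportional to `t`. -/
theorem norm_charFun_map_sub_le {X : Ω → E} (hX : MemLp X 2 P) (hmean : ∫ ω, X ω ∂P = 0)
    [CompleteSpace E] (u v : E) :
    ‖charFun (P.map X) u - charFun (P.map X) v‖ ≤
      (∫ ω, ‖X ω‖ ^ 2 ∂P) * (‖u - v‖ * (‖u‖ + ‖v‖)) := by
  have hXi : Integrable X P := hX.integrable (by norm_num)
  have hexp : ∀ u : E, Integrable (fun ω => Complex.exp (⟪X ω, u⟫_ℝ * Complex.I)) P := fun u => by
    refine Integrable.of_bound (C := 1) ?_ (Eventually.of_forall fun ω => ?_)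
    · have := hX.1
      fun_prop
    · rw [Complex.norm_exp_ofReal_mul_I]
  have hlin : Integrable (fun ω => ((⟪X ω, u⟫_ℝ : ℂ) - ⟪X ω, v⟫_ℝ) * Complex.I) P :=
    ((hXi.inner_const u).ofReal.sub (hXi.inner_const v).ofReal).mul_const _
  have hlin0 : ∫ ω, ((⟪X ω, u⟫_ℝ : ℂ) - ⟪X ω, v⟫_ℝ) * Complex.I ∂P = 0 := by
    have h0 : ∀ w, ∫ ω, ⟪X ω, w⟫_ℝ ∂P = 0 := fun w => by
      simp_rw [real_inner_comm w]
      rw [integral_inner hXi, hmean, inner_zero_right]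
    rw [integral_mul_const, integral_sub (hXi.inner_const u).ofReal (hXi.inner_const v).ofReal,
      integral_complex_ofReal, integral_complex_ofReal, h0, h0]
    simp
  have hsub : Integrable (fun ω => Complex.exp (⟪X ω, u⟫_ℝ * Complex.I) -
    Complex.exp (⟪X ω, v⟫_ℝ * Complex.I)) P := (hexp u).sub (hexp v)
  rw [charFun_map_eq_integral hX.1.aemeasurable, charFun_map_eq_integral hX.1.aemeasurable,
    ← integral_sub (hexp u) (hexp v), ← sub_zero (∫ ω, _ ∂P), ← hlin0,
    ← integral_sub hsub hlin, ← integral_mul_const]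
  refine norm_integral_le_of_norm_le ((hX.integrable_norm_pow (by norm_num)).mul_const _)
    (Eventually.of_forall fun ω => ?_)
  refine (norm_exp_mul_I_sub_sub_le ⟪X ω, u⟫_ℝ ⟪X ω, v⟫_ℝ).trans ?_
  rw [← inner_sub_right]
  calc _ ≤ (‖X ω‖ * ‖u‖ + ‖X ω‖ * ‖v‖) * (‖X ω‖ * ‖u - v‖) := by
        gcongr <;> exact abs_real_inner_le_norm _ _
    _ = _ := by ring

variable [CompleteSpace E] {U : ℝ≥0 → Ω → E}

theorem IsLevyProcess.charFun_add (hU : IsLevyProcess P U) (hsq : ∀ t, MemLp (U t) 2 P)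
    (s t : ℝ≥0) (u : E) : charFun (P.map (U (s + t))) u =
      charFun (P.map (U s)) u * charFun (P.map (U t)) u := by
  have hind := hU.indepFun_sub (le_self_add : s ≤ s + t)
  have hm : ∀ t, AEMeasurable (U t) P := fun t => (hsq t).1.aemeasurable
  have hadd := hind.charFun_map_add_eq_mul (hm s) ((hm (s + t)).sub (hm s))
  rw [add_sub_cancel] at hadd
  rw [hadd, Pi.mul_apply]
  congr 2
  exact (hU.stationary_increments s t).map_eq

/-- The Lévy exponent of a square integrable mean zero Lévy process. -/
theorem IsLevyProcess.exists_exponent (hU : IsLevyProcess P U) (hsq : ∀ t, MemLp (U t) 2 P)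
    (hmean : ∀ t, ∫ ω, U t ω ∂P = 0) :
    ∃ (ψ : E → ℂ) (K : ℝ≥0), ψ 0 = 0 ∧
      (∀ u v, ‖ψ u - ψ v‖ ≤ K * (‖u - v‖ * (‖u‖ + ‖v‖))) ∧
      ∀ (t : ℝ≥0) u, charFun (P.map (U t)) u = Complex.exp (t * ψ u) := by
  set K : ℝ≥0 := (∫ ω, ‖U 1 ω‖ ^ 2 ∂P).toNNReal with hK
  have hKc : (K : ℝ) = ∫ ω, ‖U 1 ω‖ ^ 2 ∂P :=
    Real.coe_toNNReal _ (integral_nonneg fun _ => by positivity)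
  have hprob : ∀ t, IsProbabilityMeasure (P.map (U t)) := fun t =>
    Measure.isProbabilityMeasure_map (hsq t).1.aemeasurable
  have hlip : ∀ (t : ℝ≥0) u v, ‖charFun (P.map (U t)) u - charFun (P.map (U t)) v‖ ≤
      t * K * (‖u - v‖ * (‖u‖ + ‖v‖)) := fun t u v => by
    have := norm_charFun_map_sub_le (hsq t) (hmean t) u v
    rwa [hU.integral_norm_sq hsq hmean, ← hKc] at this
  have hex : ∀ u, ∃ z : ℂ, ∀ t : ℝ≥0, charFun (P.map (U t)) u = Complex.exp (t * z) := fun u => by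
    refine exists_eq_exp_of_map_add (C := K * (‖u‖₊ * ‖u‖₊)) (fun s t => hU.charFun_add hsq s t u)
      (fun t => norm_charFun_le_one u) fun t => ?_
    have := hlip t u 0
    rw [charFun_zero, probReal_univ, sub_zero, norm_zero, add_zero] at this
    push_cast
    calc _ = _ := by simp
      _ ≤ _ := this
      _ = _ := by ring
  choose ψ hψ using hex
  -- `ψ u` is the derivative at time 0 of the characteristic function of `U t` at `u`. In the bound
  -- below, the factor `n + 1` cancels the time `1 / (n + 1)` in `hlip`.
  have hlim : ∀ u, Tendsto (fun n : ℕ => (n + 1 : ℂ) *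
      (charFun (P.map (U (1 / (n + 1)))) u - 1)) atTop (𝓝 (ψ u)) := by
    intro u
    have hd : HasDerivAt (fun x : ℝ => Complex.exp (x * ψ u)) (ψ u) 0 := by
      have := ((Complex.ofRealCLM.hasDerivAt (x := 0)).mul_const (ψ u)).cexp
      simpa using this
    have hseq : Tendsto (fun n : ℕ => (1 / ((n : ℝ) + 1))) atTop (𝓝[≠] 0) :=
      tendsto_nhdsWithin_iff.2 ⟨tendsto_one_div_add_atTop_nhds_zero_nat,
        Eventually.of_forall fun n => by
          rw [Set.mem_compl_singleton_iff]; positivity⟩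
    refine (hd.tendsto_slope.comp hseq).congr fun n => ?_
    simp [slope, hψ]
  refine ⟨ψ, K, ?_, fun u v => ?_, fun t u => hψ u t⟩
  · refine tendsto_nhds_unique (hlim 0) ?_
    simp
  · refine le_of_tendsto ((hlim u).sub (hlim v)).norm (Eventually.of_forall fun n => ?_)
    rw [← mul_sub, sub_sub_sub_cancel_right, norm_mul]
    have := hlip (1 / (n + 1)) u v
    have hn : ‖(n + 1 : ℂ)‖ = n + 1 := by
      rw [← Nat.cast_succ, Complex.norm_natCast, Nat.cast_succ]
    rw [hn]
    push_cast at this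
    calc _ ≤ ((n : ℝ) + 1) * (1 / (n + 1) * K * (‖u - v‖ * (‖u‖ + ‖v‖))) := by gcongr
      _ = _ := by field_simp

end Levy

/-! ### The exponential formula for finitely many values -/

theorem Fin.sum_ite_le_succ_sub_castSucc {M : Type*} [AddCommGroup M] {n : ℕ}
    (G : Fin (n + 1) → M) (j : Fin n) :
    ∑ m : Fin n, (if m ≤ j then G m.succ - G m.castSucc else 0) = G j.succ - G 0 := by
  induction n with
  | zero => exact j.elim0
  | succ n ih =>
    rw [Fin.sum_univ_succ]
    refine Fin.cases ?_ (fun j => ?_) j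
    · simp
    · have := ih (fun i => G i.succ) j
      simp only [Fin.succ_le_succ_iff, ← Fin.succ_castSucc, this]
      simp

section Levy

variable {Ω E ι : Type*} [MeasurableSpace Ω] {P : Measure Ω} [IsProbabilityMeasure P]
  [NormedAddCommGroup E] [InnerProductSpace ℝ E] [MeasurableSpace E]
  [BorelSpace E] [SecondCountableTopology E] [CompleteSpace E] {U : ℝ≥0 → Ω → E} {ψ : E → ℂ}

theorem IsLevyProcess.integral_exp_sum_increment (hU : IsLevyProcess P U)
    (hsq : ∀ t, MemLp (U t) 2 P)
    (hψ : ∀ (t : ℝ≥0) u, charFun (P.map (U t)) u = Complex.exp (t * ψ u))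
    {n : ℕ} {t : Fin (n + 1) → ℝ≥0} (ht : Monotone t) (x : Fin n → E) :
    ∫ ω, Complex.exp ((∑ m, ⟪U (t m.succ) ω - U (t m.castSucc) ω, x m⟫_ℝ : ℝ) * Complex.I) ∂P =
      Complex.exp (∑ m, ((t m.succ : ℝ) - t m.castSucc : ℝ) * ψ (x m)) := by
  have hm : ∀ s t, AEMeasurable (fun ω => U s ω - U t ω) P := fun s t =>
    (hsq s).1.aemeasurable.sub (hsq t).1.aemeasurable
  have hprod := (hU.indep_increments n t ht).integral_fun_prod_comp
    (f := fun m y => Complex.exp (⟪y, x m⟫_ℝ * Complex.I)) (fun m => hm _ _)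
    (fun m => by fun_prop)
  simp only [Complex.ofReal_sum, Finset.sum_mul, Complex.exp_sum]
  rw [hprod]
  refine Finset.prod_congr rfl fun m _ => ?_
  obtain ⟨d, hd⟩ := exists_add_of_le (ht (Fin.castSucc_lt_succ (i := m)).le)
  have hstat := (hU.stationary_increments (t m.castSucc) d).map_eq
  rw [← hd] at hstat
  rw [← charFun_map_eq_integral (hm _ _), hstat, hψ, hd]
  simp

theorem indicator_Ioc_zero_sub {F : Type*} [AddCommGroup F] {a b s : ℝ} (ha : 0 ≤ a) (hab : a ≤ b)
    (v : F) : (Set.Ioc 0 b).indicator (fun _ => v) s - (Set.Ioc 0 a).indicator (fun _ => v) s =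
      (Set.Ioc a b).indicator (fun _ => v) s := by
  simp only [Set.indicator_apply, Set.mem_Ioc]
  split_ifs <;> first | (exfalso; grind) | simp

/-- The intervals are disjoint, so at most one summand is nonzero at each `s` and `ψ` commutes with
the sum; `ψ 0 = 0` covers the points outside all of them. -/
theorem integral_comp_sum_indicator {n : ℕ} {t : Fin (n + 1) → ℝ≥0} (ht : Monotone t)
    (hψ0 : ψ 0 = 0) (x : Fin n → E) :
    ∫ s in Set.Ioi (0 : ℝ),
      ψ (∑ m, (Set.Ioc (t m.castSucc : ℝ) (t m.succ)).indicator (fun _ => x m) s) =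
      ∑ m, ((t m.succ : ℝ) - t m.castSucc : ℝ) * ψ (x m) := by
  have hdisj : ∀ (s : ℝ) (k m : Fin n), s ∈ Set.Ioc (t k.castSucc : ℝ) (t k.succ) →
      s ∈ Set.Ioc (t m.castSucc : ℝ) (t m.succ) → k = m := by
    intro s k m hk hm
    by_contra hne
    rcases lt_or_gt_of_ne hne with h | h
    · have : t k.succ ≤ t m.castSucc := ht (Fin.succ_le_castSucc_iff.2 h)
      have : (t k.succ : ℝ) ≤ t m.castSucc := this
      linarith [hk.2, hm.1]
    · have : t m.succ ≤ t k.castSucc := ht (Fin.succ_le_castSucc_iff.2 h)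
      have : (t m.succ : ℝ) ≤ t k.castSucc := this
      linarith [hm.2, hk.1]
  have hpt : ∀ s : ℝ,
      ψ (∑ m, (Set.Ioc (t m.castSucc : ℝ) (t m.succ)).indicator (fun _ => x m) s) =
      ∑ m, (Set.Ioc (t m.castSucc : ℝ) (t m.succ)).indicator (fun _ => ψ (x m)) s := by
    intro s
    by_cases hex : ∃ k : Fin n, s ∈ Set.Ioc (t k.castSucc : ℝ) (t k.succ)
    · obtain ⟨k, hk⟩ := hex
      rw [Finset.sum_eq_single k, Finset.sum_eq_single k, Set.indicator_of_mem hk,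
        Set.indicator_of_mem hk]
      all_goals first
        | exact fun m _ hm => Set.indicator_of_notMem (fun h => hm (hdisj s m k h hk)) _
        | simp
    · push Not at hex
      simp only [Set.indicator_of_notMem (hex _), Finset.sum_const_zero, hψ0]
  simp only [hpt]
  rw [integral_finsetSum _ fun m _ => (memLp_one_iff_integrable.1 (memLp_indicator_const 1
    measurableSet_Ioc (ψ (x m))
      (Or.inr ((Measure.restrict_apply_le _ _).trans_lt measure_Ioc_lt_top).ne)))]
  refine Finset.sum_congr rfl fun m _ => ?_
  have hle : (t m.castSucc : ℝ) ≤ t m.succ := ht (Fin.castSucc_lt_succ (i := m)).le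
  rw [setIntegral_indicator measurableSet_Ioc, Set.inter_eq_self_of_subset_right
    (show Set.Ioc (t m.castSucc : ℝ) (t m.succ) ⊆ Set.Ioi 0 from
      fun s hs => lt_of_le_of_lt (t m.castSucc).2 hs.1), setIntegral_const,
    Real.volume_real_Ioc_of_le hle, Complex.real_smul]

theorem IsLevyProcess.integral_exp_sum_of_monotone (hU : IsLevyProcess P U)
    (hsq : ∀ t, MemLp (U t) 2 P) (hψ0 : ψ 0 = 0)
    (hψ : ∀ (t : ℝ≥0) u, charFun (P.map (U t)) u = Complex.exp (t * ψ u))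
    {n : ℕ} {t : Fin n → ℝ≥0} (ht : Monotone t) (w : Fin n → E) :
    ∫ ω, Complex.exp ((∑ j, ⟪U (t j) ω, w j⟫_ℝ : ℝ) * Complex.I) ∂P =
      Complex.exp (∫ s in Set.Ioi (0 : ℝ),
        ψ (∑ j, (Set.Ioc (0 : ℝ) (t j)).indicator (fun _ => w j) s)) := by
  -- Prepending time 0 makes each value `U (t j)` a sum of increments, as `U 0 = 0` almost surely.
  set T : Fin (n + 1) → ℝ≥0 := Fin.cons 0 t with hT
  have hTm : Monotone T := by
    intro i j hij
    induction i using Fin.cases with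
    | zero => simp [hT]
    | succ i =>
      induction j using Fin.cases with
      | zero => simp at hij
      | succ j => simpa [hT] using ht (by simpa using hij)
  -- Abel summation: the increment of index `m` enters `U (t j)` for every `j ≥ m`, so its weight is
  -- the tail sum of `w`. The indicators of `(0, t j]` telescope in the same way.
  set x : Fin n → E := fun m => ∑ j, if m ≤ j then w j else 0 with hx
  have hleft : ∀ᵐ ω ∂P, ∑ j, ⟪U (t j) ω, w j⟫_ℝ =
      ∑ m : Fin n, ⟪U (T m.succ) ω - U (T m.castSucc) ω, x m⟫_ℝ := by
    filter_upwards [hU.zero] with ω hω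
    simp only [hx, inner_sum]
    rw [Finset.sum_comm]
    refine Finset.sum_congr rfl fun j _ => ?_
    have htel := Fin.sum_ite_le_succ_sub_castSucc (fun i => U (T i) ω) j
    have h0 : U (T j.succ) ω - U (T 0) ω = U (t j) ω := by simp [hT, hω]
    rw [h0] at htel
    rw [← htel, sum_inner]
    refine Finset.sum_congr rfl fun m _ => ?_
    split_ifs <;> simp
  have hright : ∀ s ∈ Set.Ioi (0 : ℝ), ψ (∑ j, (Set.Ioc (0 : ℝ) (t j)).indicator (fun _ => w j) s)
      = ψ (∑ m, (Set.Ioc (T m.castSucc : ℝ) (T m.succ)).indicator (fun _ => x m) s) := by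
    intro s hs
    congr 1
    have hind : ∀ m : Fin n, (Set.Ioc (T m.castSucc : ℝ) (T m.succ)).indicator (fun _ => x m) s =
        ∑ j, if m ≤ j then (Set.Ioc (T m.castSucc : ℝ) (T m.succ)).indicator (fun _ => w j) s
          else 0 := by
      intro m
      by_cases hm : s ∈ Set.Ioc (T m.castSucc : ℝ) (T m.succ) <;> simp [hm, hx]
    simp only [hind]
    rw [Finset.sum_comm]
    refine Finset.sum_congr rfl fun j _ => ?_
    have htel := Fin.sum_ite_le_succ_sub_castSucc
      (fun i => (Set.Ioc (0 : ℝ) (T i)).indicator (fun _ => w j) s) j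
    have h0 : (Set.Ioc (0 : ℝ) (T j.succ)).indicator (fun _ => w j) s -
        (Set.Ioc (0 : ℝ) (T 0)).indicator (fun _ => w j) s =
        (Set.Ioc (0 : ℝ) (t j)).indicator (fun _ => w j) s := by simp [hT]
    rw [h0] at htel
    rw [← htel]
    refine Finset.sum_congr rfl fun m _ => ?_
    have hle : (T m.castSucc : ℝ) ≤ T m.succ := hTm (Fin.castSucc_lt_succ (i := m)).le
    rw [indicator_Ioc_zero_sub (NNReal.coe_nonneg _) hle]
  rw [setIntegral_congr_fun measurableSet_Ioi hright, integral_comp_sum_indicator hTm hψ0,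
    ← hU.integral_exp_sum_increment hsq hψ hTm]
  refine integral_congr_ae ?_
  filter_upwards [hleft] with ω hω
  rw [hω]

/-- The joint characteristic function of finitely many values of a Lévy process. -/
theorem IsLevyProcess.integral_exp_sum [Fintype ι] (hU : IsLevyProcess P U)
    (hsq : ∀ t, MemLp (U t) 2 P) (hψ0 : ψ 0 = 0)
    (hψ : ∀ (t : ℝ≥0) u, charFun (P.map (U t)) u = Complex.exp (t * ψ u))
    (t : ι → ℝ≥0) (w : ι → E) :
    ∫ ω, Complex.exp ((∑ j, ⟪U (t j) ω, w j⟫_ℝ : ℝ) * Complex.I) ∂P =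
      Complex.exp (∫ s in Set.Ioi (0 : ℝ),
        ψ (∑ j, (Set.Ioc (0 : ℝ) (t j)).indicator (fun _ => w j) s)) := by
  let e₀ := (Fintype.equivFin ι).symm
  -- Sorting the times costs nothing, as both sums are invariant under reindexing; repeated times
  -- are allowed.
  let e := (Tuple.sort (t ∘ e₀)).trans e₀
  have hmono : Monotone (t ∘ e) := Tuple.monotone_sort (t ∘ e₀)
  have := hU.integral_exp_sum_of_monotone hsq hψ0 hψ hmono (w ∘ e)
  simp only [Function.comp_apply] at this
  have h1 : ∀ ω, ∑ j, ⟪U (t (e j)) ω, w (e j)⟫_ℝ = ∑ j, ⟪U (t j) ω, w j⟫_ℝ := fun ω =>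
    e.sum_comp fun j => ⟪U (t j) ω, w j⟫_ℝ
  have h2 : ∀ s : ℝ, ∑ j, (Set.Ioc (0 : ℝ) (t (e j))).indicator (fun _ => w (e j)) s =
      ∑ j, (Set.Ioc (0 : ℝ) (t j)).indicator (fun _ => w j) s := fun s =>
    e.sum_comp fun j => (Set.Ioc (0 : ℝ) (t j)).indicator (fun _ => w j) s
  simpa only [h1, h2] using this

end Levy

/-! ### Continuity of $\int\psi(a)$ and of characteristic functions in $L^2$ -/

section Exponent

variable {α E : Type*} [MeasurableSpace α] {μ : Measure α} [NormedAddCommGroup E]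
  {ψ : E → ℂ} {K : ℝ≥0}

theorem continuous_of_norm_sub_le_mul_add
    (hψ : ∀ u v, ‖ψ u - ψ v‖ ≤ K * (‖u - v‖ * (‖u‖ + ‖v‖))) : Continuous ψ := by
  refine continuous_iff_continuousAt.2 fun v => tendsto_iff_norm_sub_tendsto_zero.2 ?_
  refine squeeze_zero (fun _ => norm_nonneg _) (fun u => hψ u v) ?_
  have : Continuous fun u => (K : ℝ) * (‖u - v‖ * (‖u‖ + ‖v‖)) := by fun_prop
  simpa using this.tendsto v

theorem integrable_exponent_comp (hψ0 : ψ 0 = 0)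
    (hψ : ∀ u v, ‖ψ u - ψ v‖ ≤ K * (‖u - v‖ * (‖u‖ + ‖v‖))) {a : α → E} (ha : MemLp a 2 μ) :
    Integrable (fun x => ψ (a x)) μ := by
  refine ((ha.integrable_norm_pow (by norm_num)).const_mul (K : ℝ)).mono'
    ((continuous_of_norm_sub_le_mul_add hψ).comp_aestronglyMeasurable ha.1)
    (Eventually.of_forall fun x => ?_)
  simpa [hψ0, sq] using hψ (a x) 0

/-- By the quadratic bound and Hölder, $\int|\psi(a_i)-\psi(b)|\le
K\|a_i-b\|_2\,(\|a_i\|_2+\|b\|_2)$, with $\|a_i\|_2\le\|a_i-b\|_2+\|b\|_2$. -/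
theorem tendsto_integral_exponent_comp {β : Type*} {l : Filter β} (hψ0 : ψ 0 = 0)
    (hψ : ∀ u v, ‖ψ u - ψ v‖ ≤ K * (‖u - v‖ * (‖u‖ + ‖v‖))) {a : β → α → E} {b : α → E}
    (ha : ∀ i, MemLp (a i) 2 μ) (hb : MemLp b 2 μ)
    (hlim : Tendsto (fun i => eLpNorm (a i - b) 2 μ) l (𝓝 0)) :
    Tendsto (fun i => ∫ x, ψ (a i x) ∂μ) l (𝓝 (∫ x, ψ (b x) ∂μ)) := by
  refine tendsto_integral_of_L1' _ (integrable_exponent_comp hψ0 hψ hb).1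
    (Eventually.of_forall fun i => integrable_exponent_comp hψ0 hψ (ha i)) ?_
  have hbound : ∀ i, eLpNorm ((fun x => ψ (a i x)) - fun x => ψ (b x)) 1 μ ≤
      K * eLpNorm (a i - b) 2 μ * (eLpNorm (a i - b) 2 μ + eLpNorm b 2 μ + eLpNorm b 2 μ) := by
    intro i
    have hsub := (ha i).sub hb
    have hsum : eLpNorm (fun x => ‖a i x‖ + ‖b x‖) 2 μ ≤
        eLpNorm (a i - b) 2 μ + eLpNorm b 2 μ + eLpNorm b 2 μ := by
      refine (eLpNorm_add_le (ha i).norm.1 hb.norm.1 (by norm_num)).trans ?_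
      rw [eLpNorm_norm, eLpNorm_norm]
      gcongr
      calc eLpNorm (a i) 2 μ = eLpNorm ((a i - b) + b) 2 μ := by rw [sub_add_cancel]
        _ ≤ _ := eLpNorm_add_le hsub.1 hb.1 (by norm_num)
    calc _ ≤ eLpNorm (fun x => (K : ℝ) * (‖(a i - b) x‖ * (‖a i x‖ + ‖b x‖))) 1 μ :=
          eLpNorm_mono_real fun x => hψ (a i x) (b x)
      _ ≤ K * eLpNorm (a i - b) 2 μ * eLpNorm (fun x => ‖a i x‖ + ‖b x‖) 2 μ := by
          refine eLpNorm_le_eLpNorm_mul_eLpNorm_of_nnnorm hsub.1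
            ((ha i).norm.1.add hb.norm.1) (fun u r => (K : ℝ) * (‖u‖ * r)) K
            (Eventually.of_forall fun x => ?_)
          simp [mul_assoc]
      _ ≤ _ := by gcongr
  refine tendsto_of_tendsto_of_tendsto_of_le_of_le tendsto_const_nhds ?_ (fun _ => zero_le) hbound
  have h1 : Tendsto (fun i => (K : ℝ≥0∞) * eLpNorm (a i - b) 2 μ) l (𝓝 0) := by
    simpa using ENNReal.Tendsto.const_mul (a := (K : ℝ≥0∞)) hlim (Or.inr ENNReal.coe_ne_top)
  have h2 := (hlim.add_const (eLpNorm b 2 μ)).add_const (eLpNorm b 2 μ)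
  have h3 := ENNReal.Tendsto.mul h1 (Or.inr (by have := hb.2.ne; finiteness)) h2
    (Or.inr ENNReal.zero_ne_top)
  simpa using h3

/-- Holds since $|e^{\mathrm ia}-e^{\mathrm ib}|\le|a-b|$ and, on a probability space, the $L^1$
norm is at most the $L^2$ norm. -/
theorem tendsto_integral_exp_inner [IsProbabilityMeasure μ] [InnerProductSpace ℝ E] {β : Type*}
    {l : Filter β} {X : β → α → E} {Y : α → E} (hX : ∀ i, MemLp (X i) 2 μ) (hY : MemLp Y 2 μ)
    (hlim : Tendsto (fun i => eLpNorm (X i - Y) 2 μ) l (𝓝 0)) (c : E) :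
    Tendsto (fun i => ∫ x, Complex.exp (⟪X i x, c⟫_ℝ * Complex.I) ∂μ) l
      (𝓝 (∫ x, Complex.exp (⟪Y x, c⟫_ℝ * Complex.I) ∂μ)) := by
  have hint : ∀ {Z : α → E}, MemLp Z 2 μ →
      Integrable (fun x => Complex.exp (⟪Z x, c⟫_ℝ * Complex.I)) μ := fun {Z} hZ => by
    refine Integrable.of_bound (C := 1) ?_ (Eventually.of_forall fun ω => ?_)
    · have := hZ.1
      fun_prop
    · rw [Complex.norm_exp_ofReal_mul_I]
  refine tendsto_integral_of_L1' _ (hint hY).1 (Eventually.of_forall fun i => hint (hX i)) ?_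
  have hbound : ∀ i, eLpNorm ((fun x => Complex.exp (⟪X i x, c⟫_ℝ * Complex.I)) -
      fun x => Complex.exp (⟪Y x, c⟫_ℝ * Complex.I)) 1 μ ≤ ‖c‖₊ * eLpNorm (X i - Y) 2 μ := by
    intro i
    have h1 := eLpNorm_le_nnreal_smul_eLpNorm_of_ae_le_mul (μ := μ) (c := ‖c‖₊)
      (f := (fun x => Complex.exp (⟪X i x, c⟫_ℝ * Complex.I)) -
        fun x => Complex.exp (⟪Y x, c⟫_ℝ * Complex.I)) (g := X i - Y)
      (Eventually.of_forall fun x => by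
        rw [← NNReal.coe_le_coe]
        push_cast
        simp only [Pi.sub_apply]
        have e : Complex.exp (⟪X i x, c⟫_ℝ * Complex.I) - Complex.exp (⟪Y x, c⟫_ℝ * Complex.I) =
            Complex.exp (⟪Y x, c⟫_ℝ * Complex.I) *
              (Complex.exp (Complex.I * (⟪X i x - Y x, c⟫_ℝ : ℝ)) - 1) := by
          rw [mul_sub, ← Complex.exp_add, inner_sub_left]
          push_cast
          ring_nf
        rw [e, norm_mul, Complex.norm_exp_ofReal_mul_I, one_mul, mul_comm ‖c‖]
        exact Real.norm_exp_I_mul_ofReal_sub_one_le.trans (norm_inner_le_norm _ _)) 1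
    refine h1.trans ?_
    rw [ENNReal.smul_def, smul_eq_mul]
    gcongr
    exact eLpNorm_le_eLpNorm_of_exponent_le (by norm_num) ((hX i).sub hY).1
  refine tendsto_of_tendsto_of_tendsto_of_le_of_le tendsto_const_nhds ?_ (fun _ => zero_le) hbound
  simpa using ENNReal.Tendsto.const_mul (a := (‖c‖₊ : ℝ≥0∞)) hlim (Or.inr ENNReal.coe_ne_top)

end Exponent

/-! ### The argument of the bivariate exponent -/

section Bivariate

variable {α H : Type*} [MeasurableSpace α] {μ : Measure α}
  [NormedAddCommGroup H] [InnerProductSpace ℝ H]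

/-- The argument `((c, x)_H, -(c, y)_H)` at which a bivariate cumulant is evaluated. -/
noncomputable def signedPairing (c x y : H) : EuclideanSpace ℝ (Fin 2) :=
  !₂[⟪c, x⟫_ℝ, -⟪c, y⟫_ℝ]

theorem signedPairing_eq (c x y : H) : signedPairing c x y =
    ⟪c, x⟫_ℝ • EuclideanSpace.single (0 : Fin 2) (1 : ℝ) -
      ⟪c, y⟫_ℝ • EuclideanSpace.single (1 : Fin 2) (1 : ℝ) := by
  ext i
  fin_cases i <;> simp [signedPairing]

theorem signedPairing_zero (c : H) : signedPairing c 0 0 = 0 := by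
  simp [signedPairing_eq]

theorem signedPairing_sub (c x y x' y' : H) :
    signedPairing c x y - signedPairing c x' y' = signedPairing c (x - x') (y - y') := by
  simp only [signedPairing_eq, inner_sub_right, sub_smul]
  abel

theorem signedPairing_sub_left (c c' x y : H) :
    signedPairing c x y - signedPairing c' x y = signedPairing (c - c') x y := by
  simp only [signedPairing_eq, inner_sub_left, sub_smul]
  abel

theorem norm_signedPairing_le (c x y : H) : ‖signedPairing c x y‖ ≤ ‖c‖ * (‖x‖ + ‖y‖) := by
  rw [signedPairing_eq]
  refine (norm_sub_le _ _).trans ?_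
  rw [norm_smul, norm_smul, PiLp.norm_single, PiLp.norm_single, norm_one,
    mul_one, mul_one, mul_add]
  exact add_le_add (norm_inner_le_norm _ _) (norm_inner_le_norm _ _)

theorem memLp_signedPairing {f : Fin 2 → α → H} (hf : ∀ k, MemLp (f k) 2 μ) (c : H) :
    MemLp (fun s => signedPairing c (f 0 s) (f 1 s)) 2 μ := by
  simp only [signedPairing_eq]
  exact (((innerSL ℝ c).smulRight _).comp_memLp' (hf 0)).sub
    (((innerSL ℝ c).smulRight _).comp_memLp' (hf 1))

theorem eLpNorm_signedPairing_le {f : Fin 2 → α → H} (hf : ∀ k, AEStronglyMeasurable (f k) μ)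
    (c : H) : eLpNorm (fun s => signedPairing c (f 0 s) (f 1 s)) 2 μ ≤
      ‖c‖ₑ * (eLpNorm (f 0) 2 μ + eLpNorm (f 1) 2 μ) := by
  have h1 : eLpNorm (fun s => signedPairing c (f 0 s) (f 1 s)) 2 μ ≤
      ‖c‖ₑ * eLpNorm (fun s => ‖f 0 s‖ + ‖f 1 s‖) 2 μ := by
    rw [← ofReal_norm]
    refine eLpNorm_le_mul_eLpNorm_of_ae_le_mul (Eventually.of_forall fun s => ?_) 2
    refine (norm_signedPairing_le _ _ _).trans ?_
    rw [Real.norm_of_nonneg (by positivity)]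
  refine h1.trans ?_
  gcongr
  refine (eLpNorm_add_le (hf 0).norm (hf 1).norm (by norm_num)).trans ?_
  rw [eLpNorm_norm, eLpNorm_norm]

variable {ψ : EuclideanSpace ℝ (Fin 2) → ℂ} {K : ℝ≥0}

theorem tendsto_integral_signedPairing {β : Type*} {l : Filter β} (hψ0 : ψ 0 = 0)
    (hψ : ∀ u v, ‖ψ u - ψ v‖ ≤ K * (‖u - v‖ * (‖u‖ + ‖v‖))) {f : β → Fin 2 → α → H}
    {f' : Fin 2 → α → H} (hf : ∀ i k, MemLp (f i k) 2 μ) (hf' : ∀ k, MemLp (f' k) 2 μ)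
    (hlim : ∀ k, Tendsto (fun i => eLpNorm (f i k - f' k) 2 μ) l (𝓝 0)) (c : H) :
    Tendsto (fun i => ∫ s, ψ (signedPairing c (f i 0 s) (f i 1 s)) ∂μ) l
      (𝓝 (∫ s, ψ (signedPairing c (f' 0 s) (f' 1 s)) ∂μ)) := by
  refine tendsto_integral_exponent_comp hψ0 hψ (fun i => memLp_signedPairing (hf i) c)
    (memLp_signedPairing hf' c) ?_
  refine tendsto_of_tendsto_of_tendsto_of_le_of_le tendsto_const_nhds (h :=
    fun i => ‖c‖ₑ * (eLpNorm (f i 0 - f' 0) 2 μ + eLpNorm (f i 1 - f' 1) 2 μ)) ?_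
    (fun _ => zero_le) fun i => ?_
  · simpa using ENNReal.Tendsto.const_mul (a := ‖c‖ₑ) ((hlim 0).add (hlim 1))
      (Or.inr enorm_ne_top)
  · have := eLpNorm_signedPairing_le (f := fun k => f i k - f' k)
      (fun k => ((hf i k).sub (hf' k)).1) c
    simpa only [Pi.sub_def, signedPairing_sub] using this

/-- The pairing is linear in `c`, so its $L^2$ norm is controlled by `‖c‖`. This is the continuity
required of a cumulant. -/
theorem continuous_integral_signedPairing (hψ0 : ψ 0 = 0)
    (hψ : ∀ u v, ‖ψ u - ψ v‖ ≤ K * (‖u - v‖ * (‖u‖ + ‖v‖))) {f : Fin 2 → α → H}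
    (hf : ∀ k, MemLp (f k) 2 μ) :
    Continuous fun c => ∫ s, ψ (signedPairing c (f 0 s) (f 1 s)) ∂μ := by
  refine continuous_iff_continuousAt.2 fun c => ?_
  refine tendsto_integral_exponent_comp hψ0 hψ (fun c => memLp_signedPairing hf c)
    (memLp_signedPairing hf c) ?_
  refine tendsto_of_tendsto_of_tendsto_of_le_of_le tendsto_const_nhds (h :=
    fun c' => ‖c' - c‖ₑ * (eLpNorm (f 0) 2 μ + eLpNorm (f 1) 2 μ)) ?_
    (fun _ => zero_le) fun c' => ?_
  · have h0 : Tendsto (fun c' => ‖c' - c‖ₑ) (𝓝 c) (𝓝 0) := by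
      have : Continuous fun c' => ‖c' - c‖ₑ := by fun_prop
      simpa using this.tendsto c
    have h1 := (hf 0).2.ne
    have h2 := (hf 1).2.ne
    simpa using ENNReal.Tendsto.mul_const h0 (b := eLpNorm (f 0) 2 μ + eLpNorm (f 1) 2 μ)
      (Or.inr (by finiteness))
  · have := eLpNorm_signedPairing_le (fun k => (hf k).1) (c' - c)
    simpa only [Pi.sub_def, signedPairing_sub_left] using this

end Bivariate

/-! ### Characteristic functions of stochastic integrals -/

section CharFun

variable {Ω H : Type*} [MeasurableSpace Ω] {P : Measure Ω} [IsProbabilityMeasure P]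
  [NormedAddCommGroup H] [InnerProductSpace ℝ H]
  {U : ℝ≥0 → Ω → EuclideanSpace ℝ (Fin 2)} {ψ : EuclideanSpace ℝ (Fin 2) → ℂ} {K : ℝ≥0}

theorem StepFunction.inner_integral (φ : StepFunction H) (V : ℝ≥0 → Ω → ℝ) (ω : Ω) (c : H) :
    ⟪φ.integral V ω, c⟫_ℝ = ∑ i, (V (φ.hi i) ω - V (φ.lo i) ω) * ⟪c, φ.val i⟫_ℝ := by
  rw [StepFunction.integral, sum_inner]
  refine Finset.sum_congr rfl fun i _ => ?_
  rw [real_inner_smul_left, real_inner_comm]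

theorem StepFunction.inner_eval (φ : StepFunction H) {s : ℝ} (c : H) :
    ⟪c, φ.eval s⟫_ℝ = ∑ i, ((Set.Ioc 0 (φ.hi i : ℝ)).indicator (fun _ => ⟪c, φ.val i⟫_ℝ) s -
      (Set.Ioc 0 (φ.lo i : ℝ)).indicator (fun _ => ⟪c, φ.val i⟫_ℝ) s) := by
  rw [StepFunction.eval, inner_sum]
  refine Finset.sum_congr rfl fun i _ => ?_
  rw [indicator_Ioc_zero_sub (NNReal.coe_nonneg _) (by exact_mod_cast φ.lo_le_hi i)]
  by_cases hs : s ∈ Set.Ioc (φ.lo i : ℝ) (φ.hi i) <;> simp [hs]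

theorem IsLevyProcess.integral_exp_stepFunction (hU : IsLevyProcess P U)
    (hsq : ∀ t, MemLp (U t) 2 P) (hψ0 : ψ 0 = 0)
    (hψ : ∀ (t : ℝ≥0) u, charFun (P.map (U t)) u = Complex.exp (t * ψ u))
    (φ : Fin 2 → StepFunction H) (c : H) :
    ∫ ω, Complex.exp (⟪(φ 0).integral (fun s ω => U s ω 0) ω -
        (φ 1).integral (fun s ω => U s ω 1) ω, c⟫_ℝ * Complex.I) ∂P =
      Complex.exp (∫ s in Set.Ioi (0 : ℝ), ψ (signedPairing c ((φ 0).eval s) ((φ 1).eval s))) := by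
  let e : Fin 2 → EuclideanSpace ℝ (Fin 2) := fun k => EuclideanSpace.single k 1
  -- Each increment contributes its two endpoints with opposite weights along the basis vector of
  -- its component; the signs for the second component are flipped because that integral is
  -- subtracted.
  have key := hU.integral_exp_sum hsq hψ0 hψ
    (Sum.elim (Sum.elim (φ 0).hi (φ 0).lo) (Sum.elim (φ 1).hi (φ 1).lo))
    (Sum.elim (Sum.elim (fun i => ⟪c, (φ 0).val i⟫_ℝ • e 0) (fun i => -(⟪c, (φ 0).val i⟫_ℝ • e 0)))
      (Sum.elim (fun i => -(⟪c, (φ 1).val i⟫_ℝ • e 1)) (fun i => ⟪c, (φ 1).val i⟫_ℝ • e 1)))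
  simp only [Fintype.sum_sum_type, Sum.elim_inl, Sum.elim_inr] at key
  have hU' : ∀ t ω k, ⟪U t ω, e k⟫_ℝ = U t ω k := fun t ω k => by
    simp [e, EuclideanSpace.inner_single_right]
  convert key using 4 with ω
  · rw [inner_sub_left, StepFunction.inner_integral, StepFunction.inner_integral]
    congr 1
    simp only [inner_neg_right, real_inner_smul_right, hU', sub_mul, Finset.sum_sub_distrib,
      Finset.sum_neg_distrib]
    simp only [mul_comm]
    congr 1
    ring
  · rename_i s
    rw [signedPairing_eq, StepFunction.inner_eval, StepFunction.inner_eval, Finset.sum_smul,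
      Finset.sum_smul]
    have hi : ∀ (r : ℝ) (a : ℝ) (k : Fin 2), (Set.Ioc 0 r).indicator (fun _ => a) s • e k =
        (Set.Ioc 0 r).indicator (fun _ => a • e k) s := fun r a k => by
      by_cases hs : s ∈ Set.Ioc 0 r <;> simp [hs]
    have hn : ∀ (r : ℝ) (v : EuclideanSpace ℝ (Fin 2)), (Set.Ioc 0 r).indicator (fun _ => -v) s =
        -(Set.Ioc 0 r).indicator (fun _ => v) s := fun r v => by
      by_cases hs : s ∈ Set.Ioc 0 r <;> simp [hs]
    simp only [sub_smul, hn, Finset.sum_sub_distrib, Finset.sum_neg_distrib, ← hi, e]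
    congr 1
    abel

/-- The joint law of two stochastic integrals with respect to the components of a bivariate
Lévy process. -/
theorem IsLevyProcess.integral_exp_isWienerIntegral (hU : IsLevyProcess P U)
    (hsq : ∀ t, MemLp (U t) 2 P) {κ : Fin 2 → ℝ≥0}
    (hV : ∀ k, HasBrownianCovariance P (fun s ω => U s ω k) (κ k)) (hψ0 : ψ 0 = 0)
    (hψK : ∀ u v, ‖ψ u - ψ v‖ ≤ K * (‖u - v‖ * (‖u‖ + ‖v‖)))
    (hψ : ∀ (t : ℝ≥0) u, charFun (P.map (U t)) u = Complex.exp (t * ψ u))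
    {f : Fin 2 → ℝ → H} {Z : Fin 2 → Ω → H}
    (hZ : ∀ k, IsWienerIntegral P (fun s ω => U s ω k) (f k) (Z k)) (c : H) :
    ∫ ω, Complex.exp (⟪Z 0 ω - Z 1 ω, c⟫_ℝ * Complex.I) ∂P =
      Complex.exp (∫ s in Set.Ioi (0 : ℝ), ψ (signedPairing c (f 0 s) (f 1 s))) := by
  choose hf hZ2 φ hφ hφZ using hZ
  have hstep : ∀ k m, MemLp ((φ k m).integral fun s ω => U s ω k) 2 P := fun k m =>
    (hV k).memLp_integral (φ k m)
  have hleft := tendsto_integral_exp_inner (l := atTop)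
    (X := fun m ω => (φ 0 m).integral (fun s ω => U s ω 0) ω -
      (φ 1 m).integral (fun s ω => U s ω 1) ω) (Y := fun ω => Z 0 ω - Z 1 ω)
    (fun m => (hstep 0 m).sub (hstep 1 m)) ((hZ2 0).sub (hZ2 1)) (by
      refine tendsto_of_tendsto_of_tendsto_of_le_of_le tendsto_const_nhds
        (by simpa using (hφZ 0).add (hφZ 1)) (fun _ => zero_le) fun m => ?_
      have e : (fun ω => (φ 0 m).integral (fun s ω => U s ω 0) ω -
          (φ 1 m).integral (fun s ω => U s ω 1) ω) - (fun ω => Z 0 ω - Z 1 ω) =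
          (Z 1 - (φ 1 m).integral (fun s ω => U s ω 1)) -
            (Z 0 - (φ 0 m).integral (fun s ω => U s ω 0)) := by
        ext ω
        simp only [Pi.sub_apply]
        abel
      rw [e, add_comm]
      exact eLpNorm_sub_le ((hZ2 1).sub (hstep 1 m)).1 ((hZ2 0).sub (hstep 0 m)).1 (by norm_num)) c
  have hright := (tendsto_integral_signedPairing (l := atTop) hψ0 hψK
    (f := fun m k => (φ k m).eval) (f' := f) (fun m k => (φ k m).memLp_eval 2) hf
    (fun k => by
      refine (hφ k).congr fun m => ?_
      rw [← eLpNorm_neg, neg_sub]) c).cexp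
  refine tendsto_nhds_unique hleft (hright.congr fun m => ?_)
  exact (hU.integral_exp_stepFunction hsq hψ0 hψ (fun k => φ k m) c).symm

/-- The kernels and the shift `d` are left general because the formula serves three times: for the
factors, for their time-reversed substitutes and for the limit. -/
theorem IsLevyProcess.isCumulant_map {C : Type*} [CompleteSpace H] [NormedAddCommGroup C]
    [InnerProductSpace ℝ C] [CompleteSpace C] [SecondCountableTopology C] [MeasurableSpace C]
    [BorelSpace C] (hU : IsLevyProcess P U)
    (hsq : ∀ t, MemLp (U t) 2 P) {κ : Fin 2 → ℝ≥0}
    (hV : ∀ k, HasBrownianCovariance P (fun s ω => U s ω k) (κ k)) (hψ0 : ψ 0 = 0)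
    (hψK : ∀ u v, ‖ψ u - ψ v‖ ≤ K * (‖u - v‖ * (‖u‖ + ‖v‖)))
    (hψ : ∀ (t : ℝ≥0) u, charFun (P.map (U t)) u = Complex.exp (t * ψ u))
    {f : Fin 2 → ℝ → H} {Z : Fin 2 → Ω → H}
    (hZ : ∀ k, IsWienerIntegral P (fun s ω => U s ω k) (f k) (Z k)) (L : H →L[ℝ] C) (d : H) :
    IsCumulant (P.map fun ω => L (d + (Z 0 ω - Z 1 ω))) (fun u =>
      Complex.I * (⟪u, L d⟫_ℝ : ℂ) +
        ∫ s in Set.Ioi (0 : ℝ), ψ (signedPairing (L.adjoint u) (f 0 s) (f 1 s))) := by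
  have hf := fun k => (hZ k).1
  refine ⟨?_, ?_, fun u => ?_⟩
  · have := (continuous_integral_signedPairing hψ0 hψK hf).comp L.adjoint.continuous
    exact Continuous.add (by fun_prop) this
  · have : ∀ x y : H, signedPairing 0 x y = 0 := fun x y => by simp [signedPairing_eq]
    simp [this, hψ0]
  · have hm : AEMeasurable (fun ω => L (d + (Z 0 ω - Z 1 ω))) P :=
      (L.continuous.comp_aestronglyMeasurable (aestronglyMeasurable_const.add
        ((hZ 0).2.1.1.sub (hZ 1).2.1.1))).aemeasurable
    rw [charFun_map_eq_integral hm, Complex.exp_add,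
      ← hU.integral_exp_isWienerIntegral hsq hV hψ0 hψK hψ hZ, ← integral_const_mul]
    refine integral_congr_ae (Eventually.of_forall fun ω => ?_)
    simp only
    rw [← Complex.exp_add, map_add, inner_add_left, real_inner_comm,
      ContinuousLinearMap.adjoint_inner_right]
    congr 1
    push_cast
    ring

end CharFun

/-! ### Time reversal and truncation -/

section Shift

variable {H : Type*} [NormedAddCommGroup H] [InnerProductSpace ℝ H]

theorem memLp_comp_sub_left_Ioc {F : ℝ → H} (hF : MemLp F 2 (volume.restrict (Set.Ioi (0 : ℝ))))
    (t : ℝ≥0) : MemLp (fun s => F (t - s)) 2 (volume.restrict (Set.Ioc (0 : ℝ) t)) := by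
  -- Reversal carries `(0, t]` to `[0, t)`, whose endpoint 0 is a null set not covered by `hF`.
  have h1 : MemLp F 2 (volume.restrict (Set.Ico (0 : ℝ) t)) := by
    rw [← restrict_Ioo_eq_restrict_Ico]
    exact hF.mono_measure (Measure.restrict_mono (fun s hs => hs.1) le_rfl)
  have h2 := (Measure.measurePreserving_sub_left volume (t : ℝ)).restrict_preimage
    (measurableSet_Ico (a := (0 : ℝ)) (b := t))
  rw [Set.preimage_const_sub_Ico, sub_self, sub_zero] at h2
  exact h1.comp_measurePreserving h2

/-- The substitution `s ↦ t - s` behind the equality of laws; `ψ 0 = 0` lets the cut-offs be moved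
outside `ψ`. -/
theorem integral_indicator_comp_sub_left {ψ : EuclideanSpace ℝ (Fin 2) → ℂ} (hψ0 : ψ 0 = 0)
    (F : Fin 2 → ℝ → H) (t : ℝ≥0) (c : H) :
    ∫ s in Set.Ioi (0 : ℝ), ψ (signedPairing c
      ((Set.Ioc (0 : ℝ) t).indicator (fun s => F 0 (t - s)) s)
      ((Set.Ioc (0 : ℝ) t).indicator (fun s => F 1 (t - s)) s)) =
    ∫ s in Set.Ioi (0 : ℝ), ψ (signedPairing c
      ((Set.Ioc (0 : ℝ) t).indicator (F 0) s) ((Set.Ioc (0 : ℝ) t).indicator (F 1) s)) := by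
  have hind : ∀ G : Fin 2 → ℝ → H, ∫ s in Set.Ioi (0 : ℝ), ψ (signedPairing c
      ((Set.Ioc (0 : ℝ) t).indicator (G 0) s) ((Set.Ioc (0 : ℝ) t).indicator (G 1) s)) =
      ∫ s in (0 : ℝ)..t, ψ (signedPairing c (G 0 s) (G 1 s)) := by
    intro G
    have : ∀ s, ψ (signedPairing c ((Set.Ioc (0 : ℝ) t).indicator (G 0) s)
        ((Set.Ioc (0 : ℝ) t).indicator (G 1) s)) =
        (Set.Ioc (0 : ℝ) t).indicator (fun s => ψ (signedPairing c (G 0 s) (G 1 s))) s := by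
      intro s
      by_cases hs : s ∈ Set.Ioc (0 : ℝ) t
      · simp only [Set.indicator_of_mem hs]
      · simp only [Set.indicator_of_notMem hs, signedPairing_zero, hψ0]
    simp only [this]
    rw [setIntegral_indicator measurableSet_Ioc, Set.inter_eq_self_of_subset_right
      (show Set.Ioc (0 : ℝ) t ⊆ Set.Ioi 0 from fun s hs => hs.1),
      intervalIntegral.integral_of_le t.coe_nonneg]
  rw [hind F, hind fun k s => F k (t - s), intervalIntegral.integral_comp_sub_left
    (fun s => ψ (signedPairing c (F 0 s) (F 1 s))), sub_self, sub_zero]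

theorem tendsto_eLpNorm_indicator_Ioc_sub {F : ℝ → H}
    (hF : MemLp F 2 (volume.restrict (Set.Ioi (0 : ℝ)))) :
    Tendsto (fun t : ℝ≥0 => eLpNorm ((Set.Ioc (0 : ℝ) t).indicator F - F) 2
      (volume.restrict (Set.Ioi (0 : ℝ)))) atTop (𝓝 0) := by
  have hmem : ∀ t : ℝ≥0, MemLp ((Set.Ioc (0 : ℝ) t).indicator F - F) 2
      (volume.restrict (Set.Ioi (0 : ℝ))) := fun t => (hF.indicator measurableSet_Ioc).sub hF
  have hint : Tendsto (fun t : ℝ≥0 => ∫ s in Set.Ioi (0 : ℝ),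
      ‖((Set.Ioc (0 : ℝ) t).indicator F - F) s‖ ^ 2) atTop (𝓝 (∫ s in Set.Ioi (0 : ℝ), (0 : ℝ))) := by
    -- Dominated by `‖F s‖ ^ 2`; for fixed `s` the difference is zero as soon as `t ≥ s`.
    refine tendsto_integral_filter_of_dominated_convergence (fun s => ‖F s‖ ^ 2)
      (Eventually.of_forall fun t => (hmem t).1.norm.pow 2) (Eventually.of_forall fun t =>
        Eventually.of_forall fun s => ?_) (hF.integrable_norm_pow (by norm_num))
      ((ae_restrict_iff' measurableSet_Ioi).2 (Eventually.of_forall fun s hs => ?_))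
    · rw [Real.norm_of_nonneg (by positivity)]
      by_cases hs : s ∈ Set.Ioc (0 : ℝ) t <;> simp [hs]
    · refine tendsto_const_nhds.congr' ?_
      filter_upwards [eventually_ge_atTop s.toNNReal] with t ht
      have hst : s ∈ Set.Ioc (0 : ℝ) t := ⟨hs, Real.toNNReal_le_iff_le_coe.1 ht⟩
      simp [hst]
  simp only [eLpNorm_two_eq_ofReal_sqrt (hmem _)]
  simpa using ENNReal.tendsto_ofReal (hint.sqrt)

end Shift

/-! ### Passage to the limit and conclusion -/

theorem TendstoInDistribution.of_map_eq {Ω ι C : Type*} [MeasurableSpace Ω] {P : Measure Ω}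
    [IsProbabilityMeasure P] [TopologicalSpace C] [MeasurableSpace C] [OpensMeasurableSpace C]
    {l : Filter ι} {X Y : ι → Ω → C} {Z : Ω → C} [IsProbabilityMeasure (P.map Z)]
    (h : TendstoInDistribution Y l Z (fun _ => P) P) (hX : ∀ i, AEMeasurable (X i) P)
    (heq : ∀ i, P.map (X i) = P.map (Y i)) :
    TendstoInDistribution X l id (fun _ => P) (P.map Z) where
  forall_aemeasurable := hX
  aemeasurable_limit := aemeasurable_id
  tendsto := by
    simp only [heq, Measure.map_id]
    exact h.tendsto

theorem IsStochIntegral.isStochIntegral_stochIntegral {Ω E : Type*} [MeasurableSpace Ω]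
    [NormedAddCommGroup E] [NormedSpace ℝ E] {P : Measure Ω} {V : ℝ≥0 → Ω → ℝ} {f : ℝ → E}
    {t : ℝ≥0} {Z : Ω → E} (h : IsStochIntegral P V f t Z) :
    IsStochIntegral P V f t (stochIntegral P V f t) := by
  have hex : ∃ Z, IsStochIntegral P V f t Z := ⟨Z, h⟩
  rw [stochIntegral, dif_pos hex]
  exact hex.choose_spec

theorem cointegrationOperator_pricingOperator {H C : Type*} [NormedAddCommGroup H]
    [InnerProductSpace ℝ H] [NormedAddCommGroup C] [InnerProductSpace ℝ C] (L : H →L[ℝ] C)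
    (x : PiLp 2 (fun _ : Fin 3 => H)) :
    cointegrationOperator L (pricingOperator H x) = L (x 0 - x 1) := by
  simp [cointegrationOperator, pricingOperator]

theorem IsLevyProcess.exists_hasBrownianCovariance_apply {Ω : Type*} [MeasurableSpace Ω]
    {P : Measure Ω} [IsProbabilityMeasure P] {U : ℝ≥0 → Ω → EuclideanSpace ℝ (Fin 2)}
    (hU : IsLevyProcess P U) (hsq : ∀ t, MemLp (U t) 2 P) (hmean : ∀ t, ∫ ω, U t ω ∂P = 0)
    (k : Fin 2) : ∃ κ, HasBrownianCovariance P (fun s ω => U s ω k) κ := by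
  let L : EuclideanSpace ℝ (Fin 2) →L[ℝ] ℝ := EuclideanSpace.proj k
  refine (hU.clm_comp L).exists_hasBrownianCovariance (fun t => L.comp_memLp' (hsq t)) fun t => ?_
  rw [L.integral_comp_comm ((hsq t).integrable (by norm_num)), hmean, map_zero]

/-- Truncated stochastic integrals of deterministic kernels converge in distribution. -/
theorem tendstoInDistribution_isWienerIntegral {Ω H C : Type*} [MeasurableSpace Ω]
    {P : Measure Ω} [IsProbabilityMeasure P] [NormedAddCommGroup H] [InnerProductSpace ℝ H]
    [NormedAddCommGroup C] [InnerProductSpace ℝ C] [SecondCountableTopology C]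
    [MeasurableSpace C] [BorelSpace C] {V : Fin 2 → ℝ≥0 → Ω → ℝ} {κ : Fin 2 → ℝ≥0}
    (hV : ∀ k, HasBrownianCovariance P (V k) (κ k)) {F : Fin 2 → ℝ → H} {Z : Fin 2 → Ω → H}
    (hZ : ∀ k, IsWienerIntegral P (V k) (F k) (Z k)) {Y : ℝ≥0 → Fin 2 → Ω → H}
    (hY : ∀ (t : ℝ≥0) k, IsWienerIntegral P (V k) ((Set.Ioc (0 : ℝ) t).indicator (F k)) (Y t k))
    {d : ℝ≥0 → H} {dinf : H} (hd : Tendsto d atTop (𝓝 dinf)) (L : H →L[ℝ] C) :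
    TendstoInDistribution (fun t ω => L (d t + (Y t 0 ω - Y t 1 ω))) atTop
      (fun ω => L (dinf + (Z 0 ω - Z 1 ω))) (fun _ => P) P := by
  have hYm := fun t k => (hY t k).2.1
  have hZm := fun k => (hZ k).2.1
  have hstrong : ∀ t, AEStronglyMeasurable (fun ω => L (d t + (Y t 0 ω - Y t 1 ω))) P := fun t =>
    L.continuous.comp_aestronglyMeasurable
      (aestronglyMeasurable_const.add ((hYm t 0).1.sub (hYm t 1).1))
  have hstrong' : AEStronglyMeasurable (fun ω => L (dinf + (Z 0 ω - Z 1 ω))) P :=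
    L.continuous.comp_aestronglyMeasurable
      (aestronglyMeasurable_const.add ((hZm 0).1.sub (hZm 1).1))
  have hdiff : ∀ k, Tendsto (fun t => eLpNorm (Y t k - Z k) 2 P) atTop (𝓝 0) := fun k => by
    refine tendsto_of_tendsto_of_tendsto_of_le_of_le tendsto_const_nhds ?_ (fun _ => zero_le)
      fun t => (hV k).eLpNorm_isWienerIntegral_sub_le (hY t k) (hZ k)
    simpa using ENNReal.Tendsto.const_mul (a := (κ k : ℝ≥0∞))
      (tendsto_eLpNorm_indicator_Ioc_sub (hZ k).1) (Or.inr ENNReal.coe_ne_top)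
  have hconst : Tendsto (fun t => eLpNorm (fun _ : Ω => d t - dinf) 2 P) atTop (𝓝 0) := by
    have : Continuous fun x : H => ‖x - dinf‖ₑ := by fun_prop
    simpa [eLpNorm_const _ (two_ne_zero) (IsProbabilityMeasure.ne_zero P), Function.comp_def]
      using (this.tendsto dinf).comp hd
  refine TendstoInMeasure.tendstoInDistribution (tendstoInMeasure_of_tendsto_eLpNorm
    (p := 2) two_ne_zero hstrong hstrong' ?_) fun t => (hstrong t).aemeasurable
  have hbound : ∀ t, eLpNorm ((fun ω => L (d t + (Y t 0 ω - Y t 1 ω))) -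
      fun ω => L (dinf + (Z 0 ω - Z 1 ω))) 2 P ≤ ENNReal.ofReal ‖L‖ *
      (eLpNorm (fun _ : Ω => d t - dinf) 2 P +
        (eLpNorm (Y t 0 - Z 0) 2 P + eLpNorm (Y t 1 - Z 1) 2 P)) := by
    intro t
    refine (eLpNorm_le_mul_eLpNorm_of_ae_le_mul (c := ‖L‖) (g := (fun _ : Ω => d t - dinf) +
      ((Y t 0 - Z 0) - (Y t 1 - Z 1))) (Eventually.of_forall fun ω => ?_) 2).trans ?_
    · rw [Pi.sub_apply, ← map_sub]
      refine (L.le_opNorm _).trans (le_of_eq ?_)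
      congr 2
      simp only [Pi.add_apply, Pi.sub_apply]
      abel
    · gcongr
      have h0 := ((hYm t 0).sub (hZm 0)).1
      have h1 := ((hYm t 1).sub (hZm 1)).1
      refine (eLpNorm_add_le aestronglyMeasurable_const (h0.sub h1) (by norm_num)).trans ?_
      gcongr
      exact eLpNorm_sub_le h0 h1 (by norm_num)
  refine tendsto_of_tendsto_of_tendsto_of_le_of_le tendsto_const_nhds ?_ (fun _ => zero_le) hbound
  simpa using ENNReal.Tendsto.const_mul (a := ENNReal.ofReal ‖L‖)
    (hconst.add ((hdiff 0).add (hdiff 1))) (Or.inr ENNReal.ofReal_ne_top)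

theorem lemma4p7
    {Ω H C : Type*} [MeasurableSpace Ω] (P : Measure Ω) [IsProbabilityMeasure P]
    [NormedAddCommGroup H] [InnerProductSpace ℝ H] [CompleteSpace H]
    [TopologicalSpace.SeparableSpace H]
    [NormedAddCommGroup C] [InnerProductSpace ℝ C] [CompleteSpace C]
    [TopologicalSpace.SeparableSpace C] [MeasurableSpace C] [BorelSpace C]
    -- `H` is a space of real-valued measurable functions on the half line
    (ev : H →ₗ[ℝ] (ℝ≥0 → ℝ)) (hev_inj : Function.Injective ev)
    (hev_meas : ∀ f, Measurable (ev f))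
    -- every shift is a bounded operator on `H`
    (S : ℝ → H →L[ℝ] H) (hS : ∀ (t : ℝ≥0) (f : H) (x : ℝ≥0), ev (S t f) x = ev f (t + x))
    -- the bivariate, mean-zero, square integrable Lévy process
    (U : ℝ≥0 → Ω → EuclideanSpace ℝ (Fin 2)) (hU : IsLevyProcess P U)
    (hU_sq : ∀ t, MemLp (U t) 2 P) (hU_mean : ∀ t, ∫ ω, U t ω ∂P = 0)
    -- the kernels, with `s ↦ g_k(s + ·)` in `L²(ℝ₊; H)`
    (g : Fin 2 → H) (hg : ∀ k, MemLp (fun s => S s (g k)) 2 (volume.restrict (Set.Ioi (0 : ℝ))))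
    (h : Fin 2 → ℝ≥0 → H) (hinf : H)
    (hlim : Tendsto (fun t => h 0 t - h 1 t) atTop (𝓝 hinf))
    -- the three factors; the third one is arbitrary
    (X : ℝ≥0 → Ω → PiLp 2 (fun _ : Fin 3 => H))
    (hX : ∀ (k : Fin 2) (t : ℝ≥0), ∀ᵐ ω ∂P, X t ω k.castSucc =
      h k t + stochIntegral P (fun s ω' => U s ω' k) (fun s => S ((t : ℝ) - s) (g k)) t ω)
    (C₁ : H →L[ℝ] C) :
    -- the stochastic integrals and the cumulants involved exist
    (∀ (k : Fin 2) (t : ℝ≥0), IsStochIntegral P (fun s ω => U s ω k)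
      (fun s => S ((t : ℝ) - s) (g k)) t
      (stochIntegral P (fun s ω => U s ω k) (fun s => S ((t : ℝ) - s) (g k)) t)) ∧
    IsCumulant (P.map (U 1)) (cumulant (P.map (U 1))) ∧
    (∀ t, IsCumulant (P.map (fun ω => C₁ (X t ω 0 - X t ω 1)))
      (cumulant (P.map (fun ω => C₁ (X t ω 0 - X t ω 1))))) ∧
    (∀ u : C, IntegrableOn (fun s : ℝ => cumulant (P.map (U 1))
      !₂[⟪C₁.adjoint u, S s (g 0)⟫_ℝ, -⟪C₁.adjoint u, S s (g 1)⟫_ℝ]) (Set.Ioi 0)) ∧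
    -- the limiting distribution and its cumulant
    (∃ (μ : Measure C) (_ : IsProbabilityMeasure μ),
      TendstoInDistribution (fun t ω => C₁ (X t ω 0 - X t ω 1)) atTop id (fun _ => P) μ ∧
      IsCumulant μ (fun u => Complex.I * (⟪u, C₁ hinf⟫_ℝ : ℂ) +
        ∫ s in Set.Ioi (0 : ℝ), cumulant (P.map (U 1))
          !₂[⟪C₁.adjoint u, S s (g 0)⟫_ℝ, -⟪C₁.adjoint u, S s (g 1)⟫_ℝ])) ∧
    (∀ u : C, Tendsto
      (fun t => cumulant (P.map (fun ω => C₁ (X t ω 0 - X t ω 1))) u) atTop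
      (𝓝 (Complex.I * (⟪u, C₁ hinf⟫_ℝ : ℂ) +
        ∫ s in Set.Ioi (0 : ℝ), cumulant (P.map (U 1))
          !₂[⟪C₁.adjoint u, S s (g 0)⟫_ℝ, -⟪C₁.adjoint u, S s (g 1)⟫_ℝ]))) ∧
    -- the three-factor forward model is cointegrated
    IsCointegrationPricingSystem P X (pricingOperator H) (cointegrationOperator C₁) := by
  obtain ⟨ψ, K, hψ0, hψK, hψ⟩ := hU.exists_exponent hU_sq hU_mean
  choose κ hV using hU.exists_hasBrownianCovariance_apply hU_sq hU_mean
  have hcum : IsCumulant (P.map (U 1)) ψ :=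
    ⟨continuous_of_norm_sub_le_mul_add hψK, hψ0, fun u => by simp [hψ 1 u]⟩
  have hcum_eq : cumulant (P.map (U 1)) = ψ := hcum.cumulant_eq
  set F : Fin 2 → ℝ → H := fun k s => S s (g k) with hF
  have hstoch : ∀ (k : Fin 2) (t : ℝ≥0), IsStochIntegral P (fun s ω => U s ω k)
      (fun s => S ((t : ℝ) - s) (g k)) t
      (stochIntegral P (fun s ω => U s ω k) (fun s => S ((t : ℝ) - s) (g k)) t) := fun k t =>
    ((hV k).exists_isStochIntegral
      (memLp_comp_sub_left_Ioc (hg k) t)).choose_spec.isStochIntegral_stochIntegral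
  have hFind : ∀ (t : ℝ≥0) k, MemLp ((Set.Ioc (0 : ℝ) t).indicator (F k)) 2
      (volume.restrict (Set.Ioi (0 : ℝ))) := fun t k => (hg k).indicator measurableSet_Ioc
  choose Z hZ using fun k => (hV k).exists_isWienerIntegral (hg k)
  -- The time-reversed substitutes: the kernel no longer depends on `t`, only the cut-off does, so
  -- they converge in $L^2$ to `Z`.
  choose Y hY using fun (t : ℝ≥0) k => (hV k).exists_isWienerIntegral (hFind t k)
  let I : ℝ≥0 → Fin 2 → Ω → H := fun t k =>
    stochIntegral P (fun s ω => U s ω k) (fun s => S ((t : ℝ) - s) (g k)) t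
  have hXae : ∀ t, (fun ω => C₁ (X t ω 0 - X t ω 1)) =ᵐ[P]
      fun ω => C₁ (h 0 t - h 1 t + (I t 0 ω - I t 1 ω)) := fun t => by
    filter_upwards [hX 0 t, hX 1 t] with ω h0 h1
    have h0' : X t ω 0 = h 0 t + I t 0 ω := h0
    have h1' : X t ω 1 = h 1 t + I t 1 ω := h1
    rw [h0', h1', add_sub_add_comm]
  have hXmeas : ∀ t, AEMeasurable (fun ω => C₁ (X t ω 0 - X t ω 1)) P := fun t =>
    (C₁.continuous.comp_aestronglyMeasurable (aestronglyMeasurable_const.add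
      ((hstoch 0 t).2.1.1.sub (hstoch 1 t).2.1.1))).aemeasurable.congr (hXae t).symm
  let Λ : ℝ≥0 → C → ℂ := fun t u => Complex.I * (⟪u, C₁ (h 0 t - h 1 t)⟫_ℝ : ℂ) +
    ∫ s in Set.Ioi (0 : ℝ), ψ (signedPairing (C₁.adjoint u)
      ((Set.Ioc (0 : ℝ) t).indicator (F 0) s) ((Set.Ioc (0 : ℝ) t).indicator (F 1) s))
  have hcumX : ∀ t, IsCumulant (P.map fun ω => C₁ (X t ω 0 - X t ω 1)) (Λ t) := fun t => by
    rw [Measure.map_congr (hXae t)]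
    have := hU.isCumulant_map hU_sq hV hψ0 hψK hψ (fun k => (hstoch k t).isWienerIntegral) C₁
      (h 0 t - h 1 t)
    -- The factors are integrated against the reversed kernel; time reversal brings their cumulant
    -- to the form `Λ t` shared with `Y`.
    have hΛ : Λ t = _ := funext fun u => congrArg (Complex.I * (⟪u, C₁ (h 0 t - h 1 t)⟫_ℝ : ℂ) + ·)
      (integral_indicator_comp_sub_left hψ0 F t (C₁.adjoint u)).symm
    rw [hΛ]
    exact this
  have hcumY : ∀ t, IsCumulant
      (P.map fun ω => C₁ (h 0 t - h 1 t + (Y t 0 ω - Y t 1 ω))) (Λ t) := fun t =>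
    hU.isCumulant_map hU_sq hV hψ0 hψK hψ (hY t) C₁ (h 0 t - h 1 t)
  have hYdist := tendstoInDistribution_isWienerIntegral hV hZ hY hlim C₁
  -- A common cumulant gives a common characteristic function, hence a common law at each fixed `t`;
  -- no equality of processes is claimed.
  have hlaw : ∀ t, P.map (fun ω => C₁ (X t ω 0 - X t ω 1)) =
      P.map fun ω => C₁ (h 0 t - h 1 t + (Y t 0 ω - Y t 1 ω)) := fun t => by
    have := Measure.isProbabilityMeasure_map (hXmeas t)
    have := Measure.isProbabilityMeasure_map (hYdist.forall_aemeasurable t)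
    exact Measure.ext_of_charFun (funext fun u =>
      ((hcumX t).2.2 u).symm.trans ((hcumY t).2.2 u))
  have hμ : IsProbabilityMeasure (P.map fun ω => C₁ (hinf + (Z 0 ω - Z 1 ω))) :=
    Measure.isProbabilityMeasure_map hYdist.aemeasurable_limit
  have hdist := TendstoInDistribution.of_map_eq hYdist hXmeas hlaw
  rw [hcum_eq]
  refine ⟨hstoch, hcum, fun t => (hcumX t).isCumulant_cumulant, fun u => ?_,
    ⟨_, hμ, hdist, hU.isCumulant_map hU_sq hV hψ0 hψK hψ hZ C₁ hinf⟩, fun u => ?_, _, hμ, ?_⟩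
  · exact integrable_exponent_comp hψ0 hψK (memLp_signedPairing hg (C₁.adjoint u))
  · simp only [fun t => (hcumX t).cumulant_eq]
    refine Tendsto.add ?_ (tendsto_integral_signedPairing hψ0 hψK hFind hg
      (fun k => tendsto_eLpNorm_indicator_Ioc_sub (hg k)) (C₁.adjoint u))
    have hc : Continuous fun x : H => Complex.I * (⟪u, C₁ x⟫_ℝ : ℂ) := by fun_prop
    exact (hc.tendsto hinf).comp hlim
  · simpa only [cointegrationOperator_pricingOperator] using hdist
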